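/- Let $n,p,r\ge 1$ be integers with $p\ge r$, and put $q=\min(n,r)$, $m=\max(n,r)$. Let $Z$ be a random $r\times n$ matrix whose columns are i.i.d. $\mathcal N_r(0,I_r)$, let $B$ be an unknown real $p\times r$ matrix of full column rank $r$, and put $X=BZ$, $S=XX^t$, $\Sigma=BB^t$. Fix distinct row indices $\rho_1,\dots,\rho_q\in\{1,\dots,p\}$ (for instance $\rho_i=i$) and assume that the rows $\rho_1,\dots,\rho_q$ of $B$ are linearly independent. For an estimator $\delta=\delta(X)$ of $\Sigma$ let $$L_q(\delta,\Sigma)=\operatorname{tr}\Sigma^+\delta-\log\pi(\Sigma^+\delta)-q,\qquad R_q(\delta,\Sigma)=E[L_q(\delta(X),\Sigma)],$$ where $\Sigma^+$ is the Moore–Penrose inverse of $\Sigma$ and $\pi(A)$ is the product of all positive eigenvalues of $A$, counted with multiplicity. With probability one there are unique matrices $T\in\mathbb R^{p\times q}$ and $V\in\mathbb R^{n\times q}$ such that $X=TV^t$, $V^tV=I_q$, and the $q\times q$ matrix formed by the rows $\rho_1,\dots,\rho_q$ of $T$, in this order, is lower triangular with positive diagonal. Consider the class of estimators $\delta_q^T=TD_qT^t$,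 where $D_q=\operatorname{diag}(d_1,\dots,d_q)$ with positive constants $d_i$, and the estimators $\delta_q^C(a)=aS$ with a constant $a>0$. All of them have integrable loss for every such $B$. Let $d_i^{JS}=(n+r-2i+1)^{-1}$ for $i=1,\dots,q$, let $\delta_q^{JS}=T\operatorname{diag}(d_1^{JS},\dots,d_q^{JS})T^t$, and let $\delta_q^{BC}=\frac1m S$. Then, for every $B$ as above: 1. The $d_i^{JS}$ are positive, and $\delta_q^{JS}$ is the unique best estimator in the class $TD_qT^t$: $R_q(\delta_q^{JS},\Sigma)<R_q(TD_qT^t,\Sigma)$ for all positive constants $(d_1,\dots,d_q)\ne(d_1^{JS},\dots,d_q^{JS})$. 2. $\log\pi(ZZ^t)$ is integrable, and $\delta_q^{JS}$ has the constant risk $R_q(\delta_q^{JS},\Sigma)=\sum_{i=1}^q\log(n+r-2i+1)-E[\log\pi(ZZ^t)]$, which does not depend on $B$. 3. $\delta_q^{BC}$ is the unique best constant multiple of $S$: $R_q(\delta_q^{BC},\Sigma)<R_q(aS,\Sigma)$ for all constants $a>0$ with $a\neq 1/m$. 4. $R_q(\delta_q^{JS},\Sigma)\le R_q(\delta_q^{BC},\Sigma)$,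 and the inequality is strict if $q\ge 2$; that is, $\delta_q^{JS}$ strictly dominates $\delta_q^{BC}$ if $q\geq2$. -/

import Mathlib

open MeasureTheory ProbabilityTheory Matrix

namespace SingularWishart

/-- `G` satisfies the four Penrose equations for the real matrix `A`. -/
structure IsPenroseInverse {m n : ℕ} (A : Matrix (Fin m) (Fin n) ℝ)
    (G : Matrix (Fin n) (Fin m) ℝ) : Prop where
  mul_mul_self : A * G * A = A
  self_mul_mul : G * A * G = G
  symm_left : (A * G)ᵀ = A * G
  symm_right : (G * A)ᵀ = G * A

/-- The Penrose equations have at most one solution. -/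
theorem IsPenroseInverse.unique {m n : ℕ} {A : Matrix (Fin m) (Fin n) ℝ}
    {G H : Matrix (Fin n) (Fin m) ℝ} (hG : IsPenroseInverse A G) (hH : IsPenroseInverse A H) :
    G = H := by
  have h1 : A * G = A * H := by
    have e : A * H * (A * G) = A * G := by
      rw [← Matrix.mul_assoc, hH.mul_mul_self]
    have e2 : A * G * (A * H) = A * H := by
      rw [← Matrix.mul_assoc, hG.mul_mul_self]
    have e3 := congrArg Matrix.transpose e
    rw [Matrix.transpose_mul, hG.symm_left, hH.symm_left, e2] at e3
    exact e3.symm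
  have h2 : G * A = H * A := by
    have e : G * A * (H * A) = G * A := by
      rw [Matrix.mul_assoc, ← Matrix.mul_assoc A, hH.mul_mul_self]
    have e2 : H * A * (G * A) = H * A := by
      rw [Matrix.mul_assoc, ← Matrix.mul_assoc A, hG.mul_mul_self]
    have e3 := congrArg Matrix.transpose e
    rw [Matrix.transpose_mul, hG.symm_right, hH.symm_right, e2] at e3
    exact e3.symm
  calc G = G * A * G := hG.self_mul_mul.symm
    _ = H * A * H := by rw [h2, Matrix.mul_assoc, h1, ← Matrix.mul_assoc]
    _ = H := hH.self_mul_mul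

open Classical in
/-- The Moore-Penrose pseudo-inverse `A⁺`: the unique solution of the Penrose equations. -/
noncomputable def pinv {m n : ℕ} (A : Matrix (Fin m) (Fin n) ℝ) : Matrix (Fin n) (Fin m) ℝ :=
  if h : ∃ G, IsPenroseInverse A G then h.choose else 0

theorem pinv_eq {m n : ℕ} {A : Matrix (Fin m) (Fin n) ℝ} {G : Matrix (Fin n) (Fin m) ℝ}
    (hG : IsPenroseInverse A G) : pinv A = G := by
  have h : ∃ G, IsPenroseInverse A G := ⟨G, hG⟩
  rw [pinv, dif_pos h]
  exact h.choose_spec.unique hG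

/-- For `B` of full column rank the pseudo-inverse of `B * Bᵀ` exists
(so the default value in `pinv` is not used for such matrices). -/
theorem isPenroseInverse_pinv_mul_transpose {p r : ℕ} (B : Matrix (Fin p) (Fin r) ℝ)
    (hB : B.rank = r) : IsPenroseInverse (B * Bᵀ) (pinv (B * Bᵀ)) := by
  have hu : IsUnit (Bᵀ * B) := by
    rw [← Matrix.linearIndependent_cols_iff_isUnit, linearIndependent_iff_card_eq_finrank_span,
      Set.finrank, ← Matrix.rank_eq_finrank_span_cols, Matrix.rank_transpose_mul_self, hB,
      Fintype.card_fin]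
  set C := Bᵀ * B with hC
  have hd : IsUnit C.det := (Matrix.isUnit_iff_isUnit_det _).1 hu
  have hCt : Cᵀ = C := by simp [hC]
  have hit : (C⁻¹)ᵀ = C⁻¹ := by rw [Matrix.transpose_nonsing_inv, hCt]
  have l : C⁻¹ * C = 1 := Matrix.nonsing_inv_mul _ hd
  have l' : C * C⁻¹ = 1 := Matrix.mul_nonsing_inv _ hd
  have a1 : B * Bᵀ * (B * (C⁻¹ * C⁻¹) * Bᵀ) = B * C⁻¹ * Bᵀ := by
    calc B * Bᵀ * (B * (C⁻¹ * C⁻¹) * Bᵀ) = B * ((Bᵀ * B) * C⁻¹) * C⁻¹ * Bᵀ := by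
          simp only [Matrix.mul_assoc]
      _ = _ := by rw [← hC, l', Matrix.mul_one]
  have a2 : (B * (C⁻¹ * C⁻¹) * Bᵀ) * (B * Bᵀ) = B * C⁻¹ * Bᵀ := by
    calc (B * (C⁻¹ * C⁻¹) * Bᵀ) * (B * Bᵀ) = B * C⁻¹ * (C⁻¹ * (Bᵀ * B)) * Bᵀ := by
          simp only [Matrix.mul_assoc]
      _ = _ := by rw [← hC, l, Matrix.mul_one]
  have hs : (B * C⁻¹ * Bᵀ)ᵀ = B * C⁻¹ * Bᵀ := by
    simp only [Matrix.transpose_mul, Matrix.transpose_transpose, hit, Matrix.mul_assoc]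
  have key : IsPenroseInverse (B * Bᵀ) (B * (C⁻¹ * C⁻¹) * Bᵀ) := by
    refine ⟨?_, ?_, ?_, ?_⟩
    · rw [a1]
      calc B * C⁻¹ * Bᵀ * (B * Bᵀ) = B * (C⁻¹ * (Bᵀ * B)) * Bᵀ := by
            simp only [Matrix.mul_assoc]
        _ = _ := by rw [← hC, l, Matrix.mul_one]
    · rw [a2]
      calc B * C⁻¹ * Bᵀ * (B * (C⁻¹ * C⁻¹) * Bᵀ)
          = B * (C⁻¹ * (Bᵀ * B)) * (C⁻¹ * C⁻¹) * Bᵀ := by simp only [Matrix.mul_assoc]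
        _ = _ := by rw [← hC, l, Matrix.mul_one]
    · rw [a1, hs]
    · rw [a2, hs]
  rw [pinv_eq key]
  exact key

/-- `π(A)`: the product of all positive (real) eigenvalues of `A`, with multiplicity. -/
noncomputable def posEigenProd {m : ℕ} (A : Matrix (Fin m) (Fin m) ℝ) : ℝ :=
  (A.charpoly.roots.filter (fun x => 0 < x)).prod

/-- The Stein-type loss `L_q(δ, Σ) = tr(Σ⁺ δ) - log π(Σ⁺ δ) - q`. -/
noncomputable def steinLoss {p : ℕ} (q : ℕ) (δ S : Matrix (Fin p) (Fin p) ℝ) : ℝ :=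
  (pinv S * δ).trace - Real.log (posEigenProd (pinv S * δ)) - q

/-- The columns of the random `r × n` matrix `Z` are i.i.d. `N_r(0, I_r)`. -/
structure IsStdGaussianMatrix {Ω : Type*} [MeasurableSpace Ω] (μ : Measure Ω) {r n : ℕ}
    (Z : Ω → Matrix (Fin r) (Fin n) ℝ) : Prop where
  law_col : ∀ j : Fin n,
    HasLaw (fun ω => WithLp.toLp 2 (fun i : Fin r => Z ω i j))
      (stdGaussian (EuclideanSpace ℝ (Fin r))) μ
  indep_col : iIndepFun (fun (j : Fin n) (ω : Ω) => WithLp.toLp 2 (fun i : Fin r => Z ω i j)) μ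

/-- The loss of the estimator `δ` (a function of the data matrix `X = B Z`) of `Σ = B Bᵀ`,
with `q = min n r`, as a random variable. -/
noncomputable def lossVar {Ω : Type*} {p r n : ℕ} (Z : Ω → Matrix (Fin r) (Fin n) ℝ)
    (δ : Matrix (Fin p) (Fin n) ℝ → Matrix (Fin p) (Fin p) ℝ) (B : Matrix (Fin p) (Fin r) ℝ) :
    Ω → ℝ :=
  fun ω => steinLoss (min n r) (δ (B * Z ω)) (B * Bᵀ)

/-- The risk `R_q(δ, Σ) = E[L_q(δ(X), Σ)]`, where `X = B Z` and `Σ = B Bᵀ`. -/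
noncomputable def risk {Ω : Type*} [MeasurableSpace Ω] (μ : Measure Ω) {p r n : ℕ}
    (Z : Ω → Matrix (Fin r) (Fin n) ℝ)
    (δ : Matrix (Fin p) (Fin n) ℝ → Matrix (Fin p) (Fin p) ℝ) (B : Matrix (Fin p) (Fin r) ℝ) : ℝ :=
  ∫ ω, lossVar Z δ B ω ∂μ

/-- `X = T Vᵀ` is the LQ-type decomposition of `X` relative to the row selection `ρ`:
`V` has orthonormal columns, and the rows `ρ 0, ρ 1, …` of `T` form a lower triangular matrix
with positive diagonal. If `ρ` selects the first `q` rows, then this is the block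
condition `T = (T₁ᵗ, T₂ᵗ)ᵗ` with `T₁` lower triangular with positive diagonal. -/
structure IsLQ {p n q : ℕ} (ρ : Fin q ↪ Fin p) (X : Matrix (Fin p) (Fin n) ℝ)
    (T : Matrix (Fin p) (Fin q) ℝ) (V : Matrix (Fin n) (Fin q) ℝ) : Prop where
  eq_mul : X = T * Vᵀ
  orthonormal : Vᵀ * V = 1
  lower : ∀ i j : Fin q, i < j → T (ρ i) j = 0
  diag_pos : ∀ i : Fin q, 0 < T (ρ i) i

open Classical in
/-- The factor `T` of the LQ-type decomposition `X = T Vᵀ` (and `0` if there is none). -/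
noncomputable def lqT {p n q : ℕ} (ρ : Fin q ↪ Fin p) (X : Matrix (Fin p) (Fin n) ℝ) :
    Matrix (Fin p) (Fin q) ℝ :=
  if h : ∃ T : Matrix (Fin p) (Fin q) ℝ, ∃ V : Matrix (Fin n) (Fin q) ℝ, IsLQ ρ X T V
  then h.choose else 0

/-- The estimator `T D Tᵀ` with `D = diag(d)`. -/
noncomputable def deltaT {p n q : ℕ} (ρ : Fin q ↪ Fin p) (d : Fin q → ℝ)
    (X : Matrix (Fin p) (Fin n) ℝ) : Matrix (Fin p) (Fin p) ℝ :=
  lqT ρ X * Matrix.diagonal d * (lqT ρ X)ᵀ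

/-- The constants `1 / (n + r - 2 i + 1)` for `i = 1, …, q`
(the index `i : Fin q` starts at `0`, hence the shift). -/
noncomputable def dJS (n r : ℕ) (i : Fin (min n r)) : ℝ :=
  1 / ((n : ℝ) + (r : ℝ) - 2 * ((i : ℝ) + 1) + 1)

/-- The estimator `a S` with `S = X Xᵀ`. -/
def deltaC {p n : ℕ} (a : ℝ) (X : Matrix (Fin p) (Fin n) ℝ) : Matrix (Fin p) (Fin p) ℝ :=
  a • (X * Xᵀ)

/-- The constant multiple estimator `S / m`, with `m = max n r`. -/
noncomputable def deltaBC {p n : ℕ} (r : ℕ) (X : Matrix (Fin p) (Fin n) ℝ) :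
    Matrix (Fin p) (Fin p) ℝ :=
  deltaC (1 / ((max n r : ℕ) : ℝ)) X

/-- The parameter space: `B` has full column rank, and the rows selected by `ρ`
form a matrix of full row rank. -/
def paramSpace {p r q : ℕ} (ρ : Fin q ↪ Fin p) : Set (Matrix (Fin p) (Fin r) ℝ) :=
  {B | B.rank = r ∧ (B.submatrix ρ id).rank = q}

end SingularWishart

/-!
Since `Bᵀ Σ⁺ B = 1`, cyclicity of the trace and of `π` removes `B` from the loss: with `X = T Vᵀ`,
the loss of `T D Tᵀ` is `∑ dᵢ ‖(Z V)ᵢ‖² - ∑ log dᵢ - log π(Z Zᵀ) - q`, where `(Z V)ᵢ` is the `i`-th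
column of `Z V`. The selected rows of `B` factor as `L` times rows of an orthogonal matrix `O`, with
`L` lower triangular, so that `V` comes from the Gram-Schmidt process applied to the rows of `O Z`,
which has the same law as `Z`.

As in the Bartlett decomposition, the `i`-th Gram-Schmidt vector is independent of every row that
did not enter its construction, so the corresponding entry of column `i` has expected square `1`.
Together with the norms of the rows this gives the expected square norm `n + r - 2 i + 1` of
column `i`. What remains is the strict convexity of `x - log x`.

The integrability of `log π(Z Zᵀ)` comes from negative moments of determinants: a determinant with
independent entries of bounded density is affine in its corner entry, with the complementary minor
as slope, so that its moment of order `-s`, `0 < s < 1`, is bounded by induction on the size.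
-/

namespace SingularWishart

section LinearAlgebra

variable {m n : Type*}

theorem posEigenProd_mul_comm {a b : ℕ} (A : Matrix (Fin a) (Fin b) ℝ)
    (B : Matrix (Fin b) (Fin a) ℝ) : posEigenProd (A * B) = posEigenProd (B * A) := by
  have posRoots_X_pow_mul (k : ℕ) {P : Polynomial ℝ} (hP : P ≠ 0) :
      (Polynomial.X ^ k * P).roots.filter (0 < ·) = P.roots.filter (0 < ·) := by
    rw [Polynomial.roots_mul (mul_ne_zero (pow_ne_zero _ Polynomial.X_ne_zero) hP),
      Polynomial.roots_X_pow, Multiset.filter_add]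
    simp [Multiset.filter_eq_nil, Multiset.mem_nsmul]
  unfold posEigenProd
  rw [← posRoots_X_pow_mul (Fintype.card (Fin b)) (Matrix.charpoly_monic _).ne_zero,
    Matrix.charpoly_mul_comm', posRoots_X_pow_mul _ (Matrix.charpoly_monic _).ne_zero]

theorem posEigenProd_of_posDef {a : ℕ} {A : Matrix (Fin a) (Fin a) ℝ} (hA : A.PosDef) :
    posEigenProd A = A.det := by
  have roots_pos : ∀ x ∈ A.charpoly.roots, 0 < x := by
    rw [hA.isHermitian.roots_charpoly_eq_eigenvalues]
    intro x hx
    obtain ⟨i, -, rfl⟩ := Multiset.mem_map.1 hx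
    exact hA.eigenvalues_pos i
  rw [posEigenProd, Multiset.filter_eq_self.2 roots_pos,
    hA.isHermitian.roots_charpoly_eq_eigenvalues, hA.isHermitian.det_eq_prod_eigenvalues]
  rfl

theorem posSemidef_mul_transpose [Finite m] [Fintype n] (M : Matrix m n ℝ) :
    (M * Mᵀ).PosSemidef := by
  simpa only [Matrix.conjTranspose_eq_transpose_of_trivial]
    using Matrix.posSemidef_self_mul_conjTranspose M

variable [Fintype m]

theorem log_det_le_trace [DecidableEq m] {A : Matrix m m ℝ} (hA : A.PosDef) :
    Real.log A.det ≤ A.trace := by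
  have eigenvalues_pos := hA.eigenvalues_pos
  rw [hA.isHermitian.det_eq_prod_eigenvalues, hA.isHermitian.trace_eq_sum_eigenvalues]
  simp only [RCLike.ofReal_real_eq_id, id_eq]
  rw [Real.log_prod fun i _ => (eigenvalues_pos i).ne']
  exact Finset.sum_le_sum fun i _ => Real.log_le_self (eigenvalues_pos i).le

theorem one_le_det_one_add [DecidableEq m] {A : Matrix m m ℝ} (hA : A.PosSemidef) :
    1 ≤ (1 + A).det := by
  have det_eq : (1 + A).det = ∏ i, (1 + hA.isHermitian.eigenvalues i) := by
    have h := congrArg (Polynomial.eval (-1)) hA.isHermitian.charpoly_eq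
    have neg_one_sub : Matrix.scalar m (-1 : ℝ) - A = -(1 + A) := by
      rw [map_neg, map_one]; abel
    rw [Matrix.eval_charpoly, neg_one_sub, Matrix.det_neg, Polynomial.eval_prod] at h
    have eval_factor (x : ℝ) :
        Polynomial.eval (-1) (Polynomial.X - Polynomial.C x) = -(1 + x) := by
      rw [Polynomial.eval_sub, Polynomial.eval_X, Polynomial.eval_C]; ring
    simp only [RCLike.ofReal_real_eq_id, id_eq, eval_factor, Finset.prod_neg,
      Finset.card_univ] at h
    exact mul_left_cancel₀ (pow_ne_zero _ (by norm_num)) h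
  rw [det_eq]
  exact Finset.one_le_prod fun i _ => le_add_of_nonneg_right (hA.eigenvalues_nonneg i)

theorem posDef_mul_transpose [Fintype n] [DecidableEq m] {M : Matrix m n ℝ}
    (h : (M * Mᵀ).det ≠ 0) : (M * Mᵀ).PosDef :=
  (posSemidef_mul_transpose M).posDef_iff_det_ne_zero.2 h

theorem sq_det_le_det_mul_transpose_add [Fintype n] [DecidableEq m] (S : Matrix m m ℝ)
    (N : Matrix m n ℝ) : S.det ^ 2 ≤ (S * Sᵀ + N * Nᵀ).det := by
  by_cases hS : S.det = 0
  · rw [hS, zero_pow two_ne_zero]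
    exact ((posSemidef_mul_transpose S).add (posSemidef_mul_transpose N)).det_nonneg
  have S_mul_inv : S * S⁻¹ = 1 := Matrix.mul_nonsing_inv _ (isUnit_iff_ne_zero.2 hS)
  have factor : S * Sᵀ + N * Nᵀ = S * (1 + (S⁻¹ * N) * (S⁻¹ * N)ᵀ) * Sᵀ := by
    have mul_N : S * (S⁻¹ * N) = N := by rw [← Matrix.mul_assoc, S_mul_inv, Matrix.one_mul]
    rw [Matrix.mul_add, Matrix.add_mul, Matrix.mul_one, ← Matrix.mul_assoc, mul_N,
      Matrix.mul_assoc N, ← Matrix.transpose_mul, mul_N]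
  rw [factor, Matrix.det_mul, Matrix.det_mul, Matrix.det_transpose]
  nlinarith [sq_nonneg S.det, one_le_det_one_add (posSemidef_mul_transpose (S⁻¹ * N))]

theorem sq_det_submatrix_le_det_mul_transpose [Fintype n] [DecidableEq m] (M : Matrix m n ℝ)
    (e : m ↪ n) : (M.submatrix id e).det ^ 2 ≤ (M * Mᵀ).det := by
  classical
  let columns : m ⊕ ↥(Set.range e)ᶜ ≃ n :=
    (Equiv.sumCongr (Equiv.ofInjective e e.injective) (.refl _)).trans (Equiv.Set.sumCompl _)
  have split_columns : M * Mᵀ = M.submatrix id e * (M.submatrix id e)ᵀ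
      + M.submatrix id ((↑) : ↥(Set.range e)ᶜ → n) * (M.submatrix id (↑))ᵀ := by
    ext i k
    exact (columns.sum_comp fun j => M i j * M k j).symm.trans (Fintype.sum_sum_type _)
  rw [split_columns]
  exact sq_det_le_det_mul_transpose_add _ _

theorem linearIndependent_row_of_det_submatrix_ne_zero [DecidableEq m] {M : Matrix m n ℝ}
    {e : m → n} (h : (M.submatrix id e).det ≠ 0) : LinearIndependent ℝ M.row :=
  .of_comp (LinearMap.funLeft ℝ ℝ e) (Matrix.linearIndependent_rows_of_det_ne_zero h)

end LinearAlgebra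

/-! ### LQ decompositions and the Stein loss -/

section LowerTriangular

variable {ι : Type*} [LinearOrder ι] [Fintype ι]

/-- A lower triangular matrix with positive diagonal entries, the shape that makes an
LQ decomposition unique. -/
structure IsPosLower (K : Matrix ι ι ℝ) : Prop where
  lower : K.IsLowerTriangular
  diag_pos : ∀ i, 0 < K i i

theorem mul_apply_self_of_isLowerTriangular {R : Type*} [NonUnitalNonAssocSemiring R]
    {K L : Matrix ι ι R} (hK : K.IsLowerTriangular) (hL : L.IsLowerTriangular) (i : ι) :
    (K * L) i i = K i i * L i i := by
  rw [Matrix.mul_apply]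
  refine Finset.sum_eq_single i (fun k _ hk => ?_) (by simp)
  rcases lt_or_gt_of_ne hk with hki | hik
  · rw [hL hki, mul_zero]
  · rw [hK hik, zero_mul]

namespace IsPosLower

variable {K L : Matrix ι ι ℝ}

theorem isUnit_det (hK : IsPosLower K) : IsUnit K.det := by
  rw [Matrix.det_of_isLowerTriangular K hK.lower]
  exact (Finset.prod_pos fun i _ => hK.diag_pos i).ne'.isUnit

theorem mul (hK : IsPosLower K) (hL : IsPosLower L) : IsPosLower (K * L) where
  lower := hK.lower.mul hL.lower
  diag_pos i := by
    rw [mul_apply_self_of_isLowerTriangular hK.lower hL.lower]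
    exact mul_pos (hK.diag_pos i) (hL.diag_pos i)

theorem inv (hK : IsPosLower K) : IsPosLower K⁻¹ := by
  have lower_inv : K⁻¹.IsLowerTriangular := by
    let _ := Matrix.invertibleOfIsUnitDet K hK.isUnit_det
    exact Matrix.blockTriangular_inv_of_blockTriangular hK.lower
  refine ⟨lower_inv, fun i => ?_⟩
  have inv_mul_diag : K⁻¹ i i * K i i = 1 := by
    rw [← mul_apply_self_of_isLowerTriangular lower_inv hK.lower,
      Matrix.nonsing_inv_mul _ hK.isUnit_det, Matrix.one_apply_eq]
  exact pos_of_mul_pos_left (inv_mul_diag ▸ one_pos) (hK.diag_pos i).le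

theorem eq_one_of_mul_transpose_eq_one (hK : IsPosLower K) (h : K * Kᵀ = 1) : K = 1 := by
  have lower_transpose : Kᵀ.IsLowerTriangular := Matrix.inv_eq_right_inv h ▸ hK.inv.lower
  ext i j
  rcases lt_trichotomy i j with hij | rfl | hji
  · rw [hK.lower hij, Matrix.one_apply_ne hij.ne]
  · have sq_diag : K i i * K i i = 1 := by
      rw [← Matrix.one_apply_eq i, ← h,
        mul_apply_self_of_isLowerTriangular hK.lower lower_transpose, Matrix.transpose_apply]
    rw [Matrix.one_apply_eq]
    nlinarith [hK.diag_pos i]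
  · rw [← Matrix.transpose_apply K, lower_transpose hji, Matrix.one_apply_ne hji.ne']

theorem eq_of_mul_transpose_eq {n : Type*} [Fintype n] (hK : IsPosLower K) (hL : IsPosLower L)
    {V W : Matrix n ι ℝ} (hV : Vᵀ * V = 1) (hW : Wᵀ * W = 1) (h : K * Vᵀ = L * Wᵀ) : V = W := by
  have K_mul : K * (Vᵀ * W) = L := by rw [← Matrix.mul_assoc, h, Matrix.mul_assoc, hW, mul_one]
  have L_mul : L * (Vᵀ * W)ᵀ = K := by
    rw [Matrix.transpose_mul, Matrix.transpose_transpose, ← Matrix.mul_assoc, ← h,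
      Matrix.mul_assoc, hV, mul_one]
  have cancel_K : K⁻¹ * K = 1 := Matrix.nonsing_inv_mul _ hK.isUnit_det
  have change_eq : Vᵀ * W = K⁻¹ * L := by rw [← K_mul, ← Matrix.mul_assoc, cancel_K, one_mul]
  have change_isPosLower : IsPosLower (Vᵀ * W) := change_eq ▸ hK.inv.mul hL
  have change_eq_one : Vᵀ * W = 1 := change_isPosLower.eq_one_of_mul_transpose_eq_one <| by
    nth_rw 1 [change_eq]
    rw [Matrix.mul_assoc, L_mul, cancel_K]
  rw [change_eq_one, mul_one] at K_mul
  have transpose_eq : Vᵀ = Wᵀ := by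
    rw [← Matrix.one_mul Vᵀ, ← cancel_K, Matrix.mul_assoc, h, ← K_mul, ← Matrix.mul_assoc,
      cancel_K, Matrix.one_mul]
  exact Matrix.transpose_injective transpose_eq

end IsPosLower

end LowerTriangular

section LQ

variable {p n q : ℕ} {ρ : Fin q ↪ Fin p} {X : Matrix (Fin p) (Fin n) ℝ}
  {T T' : Matrix (Fin p) (Fin q) ℝ} {V V' : Matrix (Fin n) (Fin q) ℝ}

theorem IsLQ.isPosLower (h : IsLQ ρ X T V) : IsPosLower (T.submatrix ρ id) :=
  ⟨fun i j hij => h.lower i j hij, h.diag_pos⟩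

theorem IsLQ.mul_right_eq (h : IsLQ ρ X T V) : X * V = T := by
  rw [h.eq_mul, Matrix.mul_assoc, h.orthonormal, Matrix.mul_one]

theorem IsLQ.unique (h : IsLQ ρ X T V) (h' : IsLQ ρ X T' V') : T = T' ∧ V = V' := by
  have V_eq : V = V' := h.isPosLower.eq_of_mul_transpose_eq h'.isPosLower h.orthonormal
    h'.orthonormal <| calc
      T.submatrix ρ id * Vᵀ = (T * Vᵀ).submatrix ρ id := rfl
      _ = (T' * V'ᵀ).submatrix ρ id := by rw [← h.eq_mul, ← h'.eq_mul]
  exact ⟨by rw [← h.mul_right_eq, ← h'.mul_right_eq, V_eq], V_eq⟩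

theorem IsLQ.lqT_eq (h : IsLQ ρ X T V) : lqT ρ X = T := by
  have exists_isLQ : ∃ T V, IsLQ ρ X T V := ⟨T, V, h⟩
  rw [lqT, dif_pos exists_isLQ]
  obtain ⟨V', hV'⟩ := exists_isLQ.choose_spec
  exact (hV'.unique h).1

end LQ

section SteinLoss

theorem isUnit_det_transpose_mul_self {p r : ℕ} {B : Matrix (Fin p) (Fin r) ℝ}
    (hB : B.rank = r) : IsUnit (Bᵀ * B).det := by
  rw [← Matrix.isUnit_iff_isUnit_det, ← Matrix.linearIndependent_cols_iff_isUnit,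
    linearIndependent_iff_card_eq_finrank_span, Set.finrank, ← Matrix.rank_eq_finrank_span_cols,
    Matrix.rank_transpose_mul_self, hB, Fintype.card_fin]

theorem mul_left_cancel_of_rank {p r n : ℕ} {B : Matrix (Fin p) (Fin r) ℝ} (hB : B.rank = r)
    {M N : Matrix (Fin r) (Fin n) ℝ} (h : B * M = B * N) : M = N := by
  let _ := Matrix.invertibleOfIsUnitDet _ (isUnit_det_transpose_mul_self hB)
  refine Matrix.mul_right_injective_of_invertible (Bᵀ * B) ?_
  simp only [Matrix.mul_assoc, h]

theorem transpose_mul_pinv_mul {p r : ℕ} {B : Matrix (Fin p) (Fin r) ℝ} (hB : B.rank = r) :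
    Bᵀ * (pinv (B * Bᵀ) * B) = 1 := by
  let _ := Matrix.invertibleOfIsUnitDet _ (isUnit_det_transpose_mul_self hB)
  refine Matrix.mul_right_injective_of_invertible (Bᵀ * B) <|
    Matrix.mul_left_injective_of_invertible (Bᵀ * B) ?_
  calc Bᵀ * B * (Bᵀ * (pinv (B * Bᵀ) * B)) * (Bᵀ * B)
      = Bᵀ * (B * Bᵀ * pinv (B * Bᵀ) * (B * Bᵀ)) * B := by simp only [Matrix.mul_assoc]
    _ = Bᵀ * (B * Bᵀ) * B := by rw [(isPenroseInverse_pinv_mul_transpose B hB).mul_mul_self]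
    _ = Bᵀ * B * 1 * (Bᵀ * B) := by simp only [Matrix.mul_assoc, Matrix.one_mul]

theorem steinLoss_mul_mul_transpose {p r : ℕ} (q : ℕ) {B : Matrix (Fin p) (Fin r) ℝ}
    (hB : B.rank = r) (M : Matrix (Fin r) (Fin r) ℝ) :
    steinLoss q (B * M * Bᵀ) (B * Bᵀ) = M.trace - Real.log (posEigenProd M) - q := by
  have regroup : pinv (B * Bᵀ) * (B * M * Bᵀ) = pinv (B * Bᵀ) * B * (M * Bᵀ) := by
    simp only [Matrix.mul_assoc]
  rw [steinLoss, regroup, posEigenProd_mul_comm, Matrix.trace_mul_comm, Matrix.mul_assoc,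
    transpose_mul_pinv_mul hB, Matrix.mul_one]

theorem det_transpose_mul_self_ne_zero {m n : Type*} [Fintype m] [Fintype n] [DecidableEq n]
    {A : Matrix n m ℝ} {N : Matrix m n ℝ} (h : IsUnit (A * N).det) : (Nᵀ * N).det ≠ 0 := by
  have mulVec_injective : Function.Injective N.mulVec := by
    refine .of_comp (f := A.mulVec) ?_
    simpa only [Function.comp_def, Matrix.mulVec_mulVec] using
      Matrix.mulVec_injective_iff_isUnit.2 ((Matrix.isUnit_iff_isUnit_det _).2 h)
  simpa only [Matrix.conjTranspose_eq_transpose_of_trivial] using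
    (Matrix.PosDef.conjTranspose_mul_self N mulVec_injective).det_pos.ne'

variable {r q : ℕ} {N : Matrix (Fin r) (Fin q) ℝ}

theorem posEigenProd_mul_transpose (hN : (Nᵀ * N).det ≠ 0) :
    posEigenProd (N * Nᵀ) = (Nᵀ * N).det := by
  have gram_eq : Nᵀ * N = Nᵀ * Nᵀᵀ := by rw [Matrix.transpose_transpose]
  rw [posEigenProd_mul_comm, gram_eq]
  exact posEigenProd_of_posDef (posDef_mul_transpose (gram_eq ▸ hN))

theorem posEigenProd_mul_diagonal_mul_transpose (hN : (Nᵀ * N).det ≠ 0) {d : Fin q → ℝ}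
    (hd : ∀ i, 0 < d i) :
    posEigenProd (N * Matrix.diagonal d * Nᵀ) = (∏ i, d i) * posEigenProd (N * Nᵀ) := by
  let s : Matrix (Fin q) (Fin q) ℝ := Matrix.diagonal fun i => √(d i)
  have s_transpose : sᵀ = s := Matrix.diagonal_transpose _
  have s_mul_self : s * s = Matrix.diagonal d := by
    rw [Matrix.diagonal_mul_diagonal]
    exact congrArg Matrix.diagonal (funext fun i => Real.mul_self_sqrt (hd i).le)
  have det_gram : ((N * s)ᵀ * (N * s)).det = (∏ i, d i) * (Nᵀ * N).det := by
    rw [← Matrix.det_diagonal, ← s_mul_self, Matrix.transpose_mul, s_transpose]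
    rw [Matrix.mul_assoc s, ← Matrix.mul_assoc Nᵀ, Matrix.det_mul, Matrix.det_mul, Matrix.det_mul s]
    ring
  have det_gram_ne_zero : ((N * s)ᵀ * (N * s)).det ≠ 0 :=
    det_gram ▸ mul_ne_zero (Finset.prod_pos fun i _ => hd i).ne' hN
  calc posEigenProd (N * Matrix.diagonal d * Nᵀ)
      = posEigenProd ((N * s) * (N * s)ᵀ) := by
        rw [← s_mul_self, Matrix.transpose_mul, s_transpose]; simp only [Matrix.mul_assoc]
    _ = (∏ i, d i) * posEigenProd (N * Nᵀ) := by
        rw [posEigenProd_mul_transpose det_gram_ne_zero, det_gram, posEigenProd_mul_transpose hN]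

theorem trace_mul_diagonal_mul_transpose {m n R : Type*} [Fintype m] [Fintype n] [DecidableEq n]
    [CommSemiring R] (N : Matrix m n R) (d : n → R) :
    (N * Matrix.diagonal d * Nᵀ).trace = ∑ i, d i * ∑ k, N k i ^ 2 := by
  simp only [Matrix.trace, Matrix.diag_apply, Matrix.mul_apply (N := Nᵀ), Matrix.mul_diagonal,
    Matrix.transpose_apply, Finset.mul_sum]
  rw [Finset.sum_comm]
  exact Finset.sum_congr rfl fun i _ => Finset.sum_congr rfl fun k _ => by ring

theorem steinLoss_of_isLQ {p n : ℕ} {ρ : Fin q ↪ Fin p} {B : Matrix (Fin p) (Fin r) ℝ}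
    (hB : B.rank = r) {Z : Matrix (Fin r) (Fin n) ℝ} {T : Matrix (Fin p) (Fin q) ℝ}
    {V : Matrix (Fin n) (Fin q) ℝ} (h : IsLQ ρ (B * Z) T V) {d : Fin q → ℝ} (hd : ∀ i, 0 < d i) :
    steinLoss q (T * Matrix.diagonal d * Tᵀ) (B * Bᵀ)
      = ∑ i, d i * ∑ k, (Z * V) k i ^ 2 - ∑ i, Real.log (d i)
        - Real.log (posEigenProd (Z * Zᵀ)) - q := by
  have T_eq : T = B * (Z * V) := by rw [← Matrix.mul_assoc, h.mul_right_eq]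
  have gram_eq : Z * V * (Z * V)ᵀ = Z * Zᵀ := by
    rw [Matrix.transpose_mul, ← Matrix.mul_assoc]
    congr 1
    refine mul_left_cancel_of_rank hB ?_
    rw [← Matrix.mul_assoc, ← T_eq, h.eq_mul]
  have det_ne_zero : ((Z * V)ᵀ * (Z * V)).det ≠ 0 :=
    det_transpose_mul_self_ne_zero (A := B.submatrix ρ id) <| by
      have isUnit_det := h.isPosLower.isUnit_det
      rwa [T_eq] at isUnit_det
  have prod_pos : 0 < ∏ i, d i := Finset.prod_pos fun i _ => hd i
  have posEigenProd_ne_zero : posEigenProd (Z * V * (Z * V)ᵀ) ≠ 0 :=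
    posEigenProd_mul_transpose det_ne_zero ▸ det_ne_zero
  have sandwich : T * Matrix.diagonal d * Tᵀ
      = B * (Z * V * Matrix.diagonal d * (Z * V)ᵀ) * Bᵀ := by
    rw [T_eq, Matrix.transpose_mul B]; simp only [Matrix.mul_assoc]
  rw [sandwich, steinLoss_mul_mul_transpose q hB, trace_mul_diagonal_mul_transpose,
    posEigenProd_mul_diagonal_mul_transpose det_ne_zero hd,
    Real.log_mul prod_pos.ne' posEigenProd_ne_zero, Real.log_prod fun i _ => (hd i).ne', gram_eq]
  ring

end SteinLoss

section GramSchmidt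

open InnerProductSpace

variable {ι m n : Type*}

theorem orthonormal_toLp_row_iff [Fintype n] [DecidableEq ι] {U : Matrix ι n ℝ} :
    Orthonormal ℝ (fun i => WithLp.toLp 2 (U i)) ↔ U * Uᵀ = 1 := by
  rw [orthonormal_iff_ite, ← Matrix.ext_iff]
  refine forall₂_congr fun i j => ?_
  rw [EuclideanSpace.inner_toLp_toLp, star_trivial, dotProduct_comm, Matrix.one_apply]
  rfl

theorem linearIndependent_toLp_row {M : Matrix ι n ℝ} (hM : LinearIndependent ℝ M.row) :
    LinearIndependent ℝ fun i => WithLp.toLp 2 (M i) :=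
  hM.map' (WithLp.linearEquiv 2 ℝ (n → ℝ)).symm.toLinearMap (LinearEquiv.ker _)

theorem exists_orthogonal_submatrix_eq [Fintype n] [DecidableEq n] [DecidableEq ι]
    {U : Matrix ι n ℝ} (hU : U * Uᵀ = 1) (f : ι ↪ n) :
    ∃ O : Matrix n n ℝ, O * Oᵀ = 1 ∧ O.submatrix f id = U := by
  let w : n → EuclideanSpace ℝ n := fun k => WithLp.toLp 2 (Function.extend f U 0 k)
  have w_apply (i : ι) : w (f i) = WithLp.toLp 2 (U i) :=
    congrArg (WithLp.toLp 2) (f.injective.extend_apply U 0 i)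
  have orthonormal_range : Orthonormal ℝ ((Set.range f).domRestrict w) := by
    have restrict_eq : (Set.range f).domRestrict w
        = (fun i => WithLp.toLp 2 (U i)) ∘ (Equiv.ofInjective f f.injective).symm := by
      ext1 ⟨_, i, rfl⟩
      simp only [Set.domRestrict_apply, w_apply, Function.comp_apply,
        Equiv.ofInjective_symm_apply]
    rw [restrict_eq]
    exact (orthonormal_toLp_row_iff.2 hU).comp _ (Equiv.injective _)
  obtain ⟨b, hb⟩ := orthonormal_range.exists_orthonormalBasis_extension_of_card_eq (by simp)
  refine ⟨.of fun k => WithLp.ofLp (b k), orthonormal_toLp_row_iff.1 b.orthonormal, ?_⟩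
  ext i a
  simp only [Matrix.submatrix_apply, Matrix.of_apply, hb (f i) ⟨i, rfl⟩, w_apply, id]

variable [LinearOrder ι] [LocallyFiniteOrderBot ι] [WellFoundedLT ι]

theorem measurable_gramSchmidt {α E : Type*} [MeasurableSpace α] [NormedAddCommGroup E]
    [InnerProductSpace ℝ E] [SecondCountableTopology E] [MeasurableSpace E] [BorelSpace E]
    {x : α → ι → E} (hx : ∀ i, Measurable fun ω => x ω i) (j : ι) :
    Measurable fun ω => gramSchmidt ℝ (x ω) j := by
  induction j using WellFoundedLT.induction with
  | _ j ih =>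
    simp only [gramSchmidt_def ℝ _ j, Submodule.starProjection_singleton]
    refine (hx j).sub (Finset.measurable_sum _ fun i hi => ?_)
    have measurable_prev := ih i (Finset.mem_Iio.1 hi)
    exact ((measurable_prev.inner (hx j)).div
      (RCLike.measurable_ofReal.comp (measurable_prev.norm.pow_const 2))).smul measurable_prev

theorem gramSchmidt_congr {E : Type*} [NormedAddCommGroup E] [InnerProductSpace ℝ E]
    {x y : ι → E} (j : ι) (h : ∀ i ≤ j, x i = y i) : gramSchmidt ℝ x j = gramSchmidt ℝ y j := by
  induction j using WellFoundedLT.induction with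
  | _ j ih =>
    rw [gramSchmidt_def, gramSchmidt_def, h j le_rfl]
    refine congrArg _ (Finset.sum_congr rfl fun i hi => ?_)
    have hij := Finset.mem_Iio.1 hi
    rw [ih i hij fun k hk => h k (hk.trans hij.le)]

variable [Fintype n]

/-- The matrix whose rows are obtained from the rows of `M` by the Gram-Schmidt process. For
linearly independent rows, `M = (M * (gramSchmidtRows M)ᵀ) * gramSchmidtRows M` is the LQ
decomposition of `M`. -/
noncomputable def gramSchmidtRows (M : Matrix ι n ℝ) : Matrix ι n ℝ :=
  .of fun i => WithLp.ofLp (gramSchmidtNormed ℝ (fun j => WithLp.toLp 2 (M j)) i)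

theorem measurable_gramSchmidtRows (i : ι) :
    Measurable fun M : ι → n → ℝ => gramSchmidtRows (.of M) i := by
  have measurable_gs := measurable_gramSchmidt (α := ι → n → ℝ) (E := EuclideanSpace ℝ n)
    (x := fun M j => WithLp.toLp 2 (M j)) (fun j => by fun_prop) i
  have measurable_gsNormed : Measurable fun M : ι → n → ℝ =>
      gramSchmidtNormed ℝ (fun j => (WithLp.toLp 2 (M j) : EuclideanSpace ℝ n)) i := by
    unfold gramSchmidtNormed
    exact ((RCLike.measurable_ofReal (𝕜 := ℝ)).comp measurable_gs.norm).inv.smul measurable_gs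
  exact (by fun_prop : Measurable (WithLp.ofLp : EuclideanSpace ℝ n → n → ℝ)).comp
    measurable_gsNormed

theorem gramSchmidtRows_congr {M N : Matrix ι n ℝ} (i : ι) (h : ∀ j ≤ i, M j = N j) :
    gramSchmidtRows M i = gramSchmidtRows N i :=
  congrArg (fun x : EuclideanSpace ℝ n => ((‖x‖ : ℝ)⁻¹ • x).ofLp)
    (gramSchmidt_congr i fun j hj => congrArg (WithLp.toLp 2) (h j hj))

theorem dotProduct_gramSchmidtRows_self_le_one (M : Matrix ι n ℝ) (i : ι) :
    gramSchmidtRows M i ⬝ᵥ gramSchmidtRows M i ≤ 1 := by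
  set u := gramSchmidtNormed ℝ (fun j => WithLp.toLp 2 (M j)) i
  have norm_le_one : ‖u‖ ≤ 1 := by
    by_cases u_eq : u = 0
    · rw [u_eq, norm_zero]; exact zero_le_one
    · exact (gramSchmidtNormed_unit_length' u_eq).le
  have dotProduct_eq : gramSchmidtRows M i ⬝ᵥ gramSchmidtRows M i = ‖u‖ ^ 2 := by
    rw [← real_inner_self_eq_norm_sq]
    rfl
  rw [dotProduct_eq]
  exact pow_le_one₀ (norm_nonneg u) norm_le_one

theorem mul_gramSchmidtRows_transpose_apply (N : Matrix m n ℝ) (M : Matrix ι n ℝ) (k : m)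
    (i : ι) : (N * (gramSchmidtRows M)ᵀ) k i
      = inner ℝ (gramSchmidtNormed ℝ (fun j => WithLp.toLp 2 (M j)) i) (WithLp.toLp 2 (N k)) :=
  rfl

theorem isLowerTriangular_mul_gramSchmidtRows_transpose (M : Matrix ι n ℝ) :
    (M * (gramSchmidtRows M)ᵀ).IsLowerTriangular := fun i j hij => by
  rw [mul_gramSchmidtRows_transpose_apply, gramSchmidtNormed, inner_smul_left,
    gramSchmidt_inv_triangular ℝ _ (OrderDual.toDual_lt_toDual.1 hij), mul_zero]

section LinearIndependent

variable {M : Matrix ι n ℝ} (hM : LinearIndependent ℝ M.row)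

include hM

theorem gramSchmidtRows_mul_transpose : gramSchmidtRows M * (gramSchmidtRows M)ᵀ = 1 :=
  orthonormal_toLp_row_iff.1 (gramSchmidtNormed_orthonormal (linearIndependent_toLp_row hM))

theorem mul_gramSchmidtRows_transpose_apply_self_pos (i : ι) :
    0 < (M * (gramSchmidtRows M)ᵀ) i i := by
  let x : ι → EuclideanSpace ℝ n := fun j => WithLp.toLp 2 (M j)
  have gramSchmidt_ne : gramSchmidt ℝ x i ≠ 0 :=
    gramSchmidt_ne_zero i (linearIndependent_toLp_row hM)
  have inner_eq : inner ℝ (gramSchmidt ℝ x i) (x i) = ‖gramSchmidt ℝ x i‖ ^ 2 := by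
    conv_lhs => rw [gramSchmidt_def'' ℝ x i]
    rw [inner_add_right, inner_sum, Finset.sum_eq_zero, add_zero, real_inner_self_eq_norm_sq]
    intro k hk
    rw [inner_smul_right, gramSchmidt_orthogonal ℝ _ (Finset.mem_Iio.1 hk).ne', mul_zero]
  have norm_pos : 0 < ‖gramSchmidt ℝ x i‖ := norm_pos_iff.2 gramSchmidt_ne
  rw [mul_gramSchmidtRows_transpose_apply, gramSchmidtNormed, inner_smul_left, inner_eq]
  simp only [map_inv₀, RCLike.ofReal_real_eq_id, id_eq, conj_trivial]
  exact mul_pos (inv_pos.2 norm_pos) (pow_pos norm_pos 2)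

theorem isPosLower_mul_gramSchmidtRows_transpose : IsPosLower (M * (gramSchmidtRows M)ᵀ) :=
  ⟨isLowerTriangular_mul_gramSchmidtRows_transpose M,
    mul_gramSchmidtRows_transpose_apply_self_pos hM⟩

variable [Fintype ι]

theorem mul_gramSchmidtRows_transpose_mul : M * (gramSchmidtRows M)ᵀ * gramSchmidtRows M = M := by
  let v : ι → EuclideanSpace ℝ n := gramSchmidtNormed ℝ fun j => WithLp.toLp 2 (M j)
  have orthonormal_v : Orthonormal ℝ v :=
    gramSchmidtNormed_orthonormal (linearIndependent_toLp_row hM)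
  ext i a
  have mem_span : WithLp.toLp 2 (M i) ∈ Submodule.span ℝ (Set.range v) := by
    rw [span_gramSchmidtNormed_range, span_gramSchmidt]
    exact Submodule.subset_span ⟨i, rfl⟩
  obtain ⟨c, hc⟩ := (Submodule.mem_span_range_iff_exists_fun ℝ).1 mem_span
  have coeff_eq (j : ι) : (M * (gramSchmidtRows M)ᵀ) i j = c j := by
    rw [mul_gramSchmidtRows_transpose_apply, ← hc, orthonormal_v.inner_right_fintype]
  have row_apply : ∑ j, c j * v j a = M i a := by
    simpa only [WithLp.ofLp_sum, WithLp.ofLp_smul, Finset.sum_apply, Pi.smul_apply, smul_eq_mul]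
      using congrArg (fun x : EuclideanSpace ℝ n => x a) hc
  rw [Matrix.mul_apply, ← row_apply]
  exact Finset.sum_congr rfl fun j _ => by rw [coeff_eq]; rfl

theorem exists_isPosLower_mul_orthogonal [DecidableEq n] (f : ι ↪ n) :
    ∃ (L : Matrix ι ι ℝ) (O : Matrix n n ℝ),
      IsPosLower L ∧ O * Oᵀ = 1 ∧ M = L * O.submatrix f id := by
  obtain ⟨O, hO, O_submatrix⟩ :=
    exists_orthogonal_submatrix_eq (gramSchmidtRows_mul_transpose hM) f
  refine ⟨_, O, isPosLower_mul_gramSchmidtRows_transpose hM, hO, ?_⟩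
  rw [O_submatrix, mul_gramSchmidtRows_transpose_mul hM]

end LinearIndependent

theorem mul_gramSchmidtRows_submatrix_transpose_mul [Fintype ι] {M : Matrix m n ℝ} {f : ι → m}
    (hf : Function.Surjective f ∨ Fintype.card ι = Fintype.card n)
    (hM : LinearIndependent ℝ (M.submatrix f id).row) :
    M * (gramSchmidtRows (M.submatrix f id))ᵀ * gramSchmidtRows (M.submatrix f id) = M := by
  rcases hf with f_surj | card_eq
  · ext k a
    obtain ⟨i, rfl⟩ := f_surj k
    exact congrFun (congrFun (mul_gramSchmidtRows_transpose_mul hM) i) a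
  · classical
    rw [Matrix.mul_assoc, (Matrix.mul_eq_one_comm_of_card_eq _ _ _ card_eq).1
      (gramSchmidtRows_mul_transpose hM), Matrix.mul_one]

theorem isLQ_gramSchmidtRows {p q r n : ℕ} {ρ : Fin q ↪ Fin p} {f : Fin q → Fin r}
    (hf : Function.Surjective f ∨ q = n) {B : Matrix (Fin p) (Fin r) ℝ}
    {L : Matrix (Fin q) (Fin q) ℝ} {O : Matrix (Fin r) (Fin r) ℝ} (hL : IsPosLower L)
    (hO : O * Oᵀ = 1) (hB : B.submatrix ρ id = L * O.submatrix f id)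
    {Z : Matrix (Fin r) (Fin n) ℝ}
    (hZ : LinearIndependent ℝ ((O * Z).submatrix f id).row) :
    IsLQ ρ (B * Z) (B * (Z * (gramSchmidtRows ((O * Z).submatrix f id))ᵀ))
      (gramSchmidtRows ((O * Z).submatrix f id))ᵀ := by
  set M := (O * Z).submatrix f id
  set U := gramSchmidtRows M
  have Z_eq : Z = Z * Uᵀ * U := by
    have OZ_eq : O * Z * Uᵀ * U = O * Z :=
      mul_gramSchmidtRows_submatrix_transpose_mul (by simpa using hf) hZ
    have transpose_mul_O : Oᵀ * O = 1 := mul_eq_one_comm.1 hO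
    calc Z = Oᵀ * (O * Z) := by rw [← Matrix.mul_assoc, transpose_mul_O, Matrix.one_mul]
      _ = Oᵀ * O * (Z * Uᵀ * U) := by rw [← OZ_eq]; simp only [Matrix.mul_assoc]
      _ = Z * Uᵀ * U := by rw [transpose_mul_O, Matrix.one_mul]
  have isPosLower_rows : IsPosLower ((B * (Z * Uᵀ)).submatrix ρ id) := by
    have rows_eq : (B * (Z * Uᵀ)).submatrix ρ id = L * (M * Uᵀ) := calc
      _ = B.submatrix ρ id * (Z * Uᵀ) := rfl
      _ = L * (O.submatrix f id * Z * Uᵀ) := by rw [hB]; simp only [Matrix.mul_assoc]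
      _ = L * (M * Uᵀ) := rfl
    exact rows_eq ▸ hL.mul (isPosLower_mul_gramSchmidtRows_transpose hZ)
  refine ⟨?_, ?_, fun i j hij => isPosLower_rows.lower hij, isPosLower_rows.diag_pos⟩
  · rw [Matrix.transpose_transpose, Matrix.mul_assoc, ← Z_eq]
  · rw [Matrix.transpose_transpose, gramSchmidtRows_mul_transpose hZ]

end GramSchmidt

/-! ### Negative moments of determinants -/

section NegativeMoments

open scoped ENNReal NNReal

/-- An upper bound for the moment of order `-s` of every translate of a real random variable whose
density is at most `κ`: the contribution of `(-1, 1)` is controlled by the density, the remaining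
one by `1`. -/
noncomputable def negMomentBound (κ : ℝ≥0) (s : ℝ) : ℝ≥0∞ :=
  1 + κ * ∫⁻ x in Metric.ball (0 : ℝ) 1, ‖x‖ₑ ^ (-s)

theorem enorm_abs_rpow {x : ℝ} (hx : x ≠ 0) (y : ℝ) : ‖|x| ^ y‖ₑ = ‖x‖ₑ ^ y := by
  rw [Real.enorm_of_nonneg (Real.rpow_nonneg (abs_nonneg x) y), Real.enorm_eq_ofReal_abs,
    ENNReal.ofReal_rpow_of_pos (abs_pos.2 hx)]

theorem negMomentBound_lt_top (κ : ℝ≥0) {s : ℝ} (hs : s < 1) : negMomentBound κ s < ∞ := by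
  have integrableOn_rpow : IntegrableOn (fun x : ℝ => |x| ^ (-s)) (Metric.ball 0 1) :=
    integrableOn_ball_of_norm_le_rpow (C := 1) (by simp) (by simpa using hs)
      (.of_forall fun x => by simp [abs_of_nonneg (Real.rpow_nonneg (abs_nonneg x) _)])
      (by fun_prop : Measurable fun x : ℝ => |x| ^ (-s)).aestronglyMeasurable
  have enorm_rpow : ∀ᵐ x ∂volume.restrict (Metric.ball (0 : ℝ) 1),
      ‖x‖ₑ ^ (-s) = ‖|x| ^ (-s)‖ₑ := by
    filter_upwards [Measure.ae_ne _ 0] with x hx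
    exact (enorm_abs_rpow hx _).symm
  refine ENNReal.add_lt_top.2 ⟨ENNReal.one_lt_top, ENNReal.mul_lt_top ENNReal.coe_lt_top ?_⟩
  rw [lintegral_congr_ae enorm_rpow]
  exact integrableOn_rpow.2

variable {κ : ℝ≥0} {s : ℝ}

theorem lintegral_enorm_add_rpow_neg_le {P : Measure ℝ} [IsProbabilityMeasure P]
    (hP : P ≤ κ • volume) (hs : 0 < s) (t : ℝ) :
    ∫⁻ x, ‖x + t‖ₑ ^ (-s) ∂P ≤ negMomentBound κ s := by
  let g : ℝ → ℝ≥0∞ := (Metric.ball (0 : ℝ) 1).indicator fun x => ‖x‖ₑ ^ (-s)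
  have rpow_le (x : ℝ) : ‖x‖ₑ ^ (-s) ≤ 1 + g x := by
    by_cases hx : x ∈ Metric.ball (0 : ℝ) 1
    · simp only [g, Set.indicator_of_mem hx, le_add_self]
    · refine le_add_right ?_
      rw [ENNReal.rpow_neg, ENNReal.inv_le_one]
      refine ENNReal.one_le_rpow ?_ hs
      rw [Real.enorm_eq_ofReal_abs, ENNReal.one_le_ofReal]
      simpa using hx
  calc ∫⁻ x, ‖x + t‖ₑ ^ (-s) ∂P
      ≤ ∫⁻ x, (1 + g (x + t)) ∂P := lintegral_mono fun x => rpow_le _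
    _ = 1 + ∫⁻ x, g (x + t) ∂P := by
        rw [lintegral_add_left measurable_const, lintegral_one, measure_univ]
    _ ≤ 1 + ∫⁻ x, g (x + t) ∂(κ • volume) := by gcongr
    _ = negMomentBound κ s := by
        rw [lintegral_smul_measure, lintegral_add_right_eq_self g t,
          lintegral_indicator Metric.isOpen_ball.measurableSet]
        rfl

theorem lintegral_enorm_mul_add_rpow_neg_le {P : Measure ℝ} [IsProbabilityMeasure P]
    (hP : P ≤ κ • volume) (hs : 0 < s) (c a : ℝ) :
    ∫⁻ x, ‖x * c + a‖ₑ ^ (-s) ∂P ≤ negMomentBound κ s * ‖c‖ₑ ^ (-s) := by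
  obtain rfl | hc := eq_or_ne c 0
  -- For `c = 0` the right-hand side is `∞`, because `s` and `negMomentBound κ s` are positive.
  · have bound_ne_zero : negMomentBound κ s ≠ 0 := by simp [negMomentBound]
    simp [ENNReal.zero_rpow_of_neg, hs, ENNReal.mul_top bound_ne_zero]
  have factor_slope (x : ℝ) : ‖x * c + a‖ₑ ^ (-s) = ‖x + a / c‖ₑ ^ (-s) * ‖c‖ₑ ^ (-s) := by
    rw [← ENNReal.mul_rpow_of_ne_top (by simp) (by simp), ← enorm_mul, add_mul,
      div_mul_cancel₀ a hc]
  simp only [factor_slope]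
  rw [lintegral_mul_const _ (by fun_prop)]
  gcongr
  exact lintegral_enorm_add_rpow_neg_le hP hs _

variable {Ω : Type*} [MeasurableSpace Ω] {μ : Measure Ω}

theorem aemeasurable_det {m : Type*} [Fintype m] [DecidableEq m] {A : Ω → Matrix m m ℝ}
    (hA : ∀ i j, AEMeasurable (fun ω => A ω i j) μ) : AEMeasurable (fun ω => (A ω).det) μ := by
  simp only [Matrix.det_apply]
  exact Finset.aemeasurable_fun_sum _ fun σ _ =>
    (Finset.aemeasurable_fun_prod _ fun i _ => hA _ _).const_smul _

/-- The part of the cofactor expansion of `A.det` along the first row that does not involve the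
corner entry `A 0 0`. -/
noncomputable def detOffCorner {k : ℕ} (A : Matrix (Fin (k + 1)) (Fin (k + 1)) ℝ) : ℝ :=
  ∑ j : Fin k, (-1) ^ (j.succ : ℕ) * A 0 j.succ * (A.submatrix Fin.succ j.succ.succAbove).det

theorem det_eq_mul_det_submatrix_succ_add_detOffCorner {k : ℕ}
    (A : Matrix (Fin (k + 1)) (Fin (k + 1)) ℝ) :
    A.det = A 0 0 * (A.submatrix Fin.succ Fin.succ).det + detOffCorner A := by
  rw [Matrix.det_succ_row_zero, Fin.sum_univ_succ]
  simp [detOffCorner]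

theorem indepFun_corner_minor_detOffCorner {k : ℕ}
    {A : Ω → Matrix (Fin (k + 1)) (Fin (k + 1)) ℝ}
    (hind : iIndepFun (fun (p : Fin (k + 1) × Fin (k + 1)) ω => A ω p.1 p.2) μ)
    (hm : ∀ i j, AEMeasurable (fun ω => A ω i j) μ) :
    IndepFun (fun ω => A ω 0 0)
      (fun ω => (((A ω).submatrix Fin.succ Fin.succ).det, detOffCorner (A ω))) μ := by
  let S : Finset (Fin (k + 1) × Fin (k + 1)) := {(0, 0)}
  have row_mem (i : Fin k) (j : Fin (k + 1)) : (i.succ, j) ∈ Sᶜ := by simp [S]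
  have col_mem (j : Fin k) : ((0 : Fin (k + 1)), j.succ) ∈ Sᶜ := by simp [S]
  have indep_compl := hind.indepFun_finset₀ S Sᶜ disjoint_compl_right fun p => hm p.1 p.2
  let minor (y : (Sᶜ : Finset _) → ℝ) (f : Fin k → Fin (k + 1)) : ℝ :=
    (Matrix.of fun i j => y ⟨(i.succ, f j), row_mem i _⟩).det
  have measurable_minor (f) : Measurable (minor · f) := by
    refine Continuous.measurable ?_
    fun_prop
  refine indep_compl.comp (φ := fun x : S → ℝ => x ⟨(0, 0), Finset.mem_singleton_self _⟩)
    (ψ := fun y => (minor y Fin.succ, ∑ j : Fin k,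
      (-1) ^ (j.succ : ℕ) * y ⟨(0, j.succ), col_mem j⟩ * minor y j.succ.succAbove))
    (by fun_prop) (by fun_prop)

variable [IsProbabilityMeasure μ]

theorem lintegral_enorm_mul_add_rpow_neg_le_of_indepFun {X c a : Ω → ℝ}
    (hX : AEMeasurable X μ) (hc : AEMeasurable c μ) (ha : AEMeasurable a μ)
    (hlaw : μ.map X ≤ κ • volume) (hs : 0 < s) (hind : IndepFun X (fun ω => (c ω, a ω)) μ) :
    ∫⁻ ω, ‖X ω * c ω + a ω‖ₑ ^ (-s) ∂μ ≤ negMomentBound κ s * ∫⁻ ω, ‖c ω‖ₑ ^ (-s) ∂μ := by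
  have hca : AEMeasurable (fun ω => (c ω, a ω)) μ := hc.prodMk ha
  have map_eq_prod := (indepFun_iff_map_prod_eq_prod_map_map hX hca).1 hind
  have := Measure.isProbabilityMeasure_map hX
  have := Measure.isProbabilityMeasure_map hca
  calc ∫⁻ ω, ‖X ω * c ω + a ω‖ₑ ^ (-s) ∂μ
      = ∫⁻ z, ‖z.1 * z.2.1 + z.2.2‖ₑ ^ (-s) ∂(μ.map X).prod (μ.map fun ω => (c ω, a ω)) := by
        rw [← map_eq_prod, lintegral_map' (by fun_prop) (hX.prodMk hca)]
    _ = ∫⁻ y, ∫⁻ x, ‖x * y.1 + y.2‖ₑ ^ (-s) ∂μ.map X ∂μ.map fun ω => (c ω, a ω) :=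
        lintegral_prod_symm' _ (by fun_prop)
    _ ≤ ∫⁻ y, negMomentBound κ s * ‖y.1‖ₑ ^ (-s) ∂μ.map fun ω => (c ω, a ω) :=
        lintegral_mono fun y => lintegral_enorm_mul_add_rpow_neg_le hlaw hs _ _
    _ = negMomentBound κ s * ∫⁻ ω, ‖c ω‖ₑ ^ (-s) ∂μ := by
        rw [lintegral_const_mul _ (by fun_prop), lintegral_map' (by fun_prop) hca]

theorem lintegral_enorm_det_rpow_neg_le {k : ℕ} {A : Ω → Matrix (Fin k) (Fin k) ℝ}
    (hind : iIndepFun (fun (p : Fin k × Fin k) ω => A ω p.1 p.2) μ)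
    (hm : ∀ i j, AEMeasurable (fun ω => A ω i j) μ)
    (hlaw : ∀ i j, μ.map (fun ω => A ω i j) ≤ κ • volume) (hs : 0 < s) :
    ∫⁻ ω, ‖(A ω).det‖ₑ ^ (-s) ∂μ ≤ negMomentBound κ s ^ k := by
  induction k with
  | zero => simp
  | succ k ih =>
    have succ_prod_injective := (Fin.succ_injective k).prodMap (Fin.succ_injective k)
    have indep_corner := indepFun_corner_minor_detOffCorner hind hm
    have hca : AEMeasurable (fun ω => detOffCorner (A ω)) μ :=
      Finset.aemeasurable_fun_sum _ fun j _ =>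
        ((hm _ _).const_mul _).mul (aemeasurable_det fun _ _ => hm _ _)
    calc ∫⁻ ω, ‖(A ω).det‖ₑ ^ (-s) ∂μ
        ≤ negMomentBound κ s * ∫⁻ ω, ‖((A ω).submatrix Fin.succ Fin.succ).det‖ₑ ^ (-s) ∂μ := by
          simp only [det_eq_mul_det_submatrix_succ_add_detOffCorner]
          exact lintegral_enorm_mul_add_rpow_neg_le_of_indepFun (hm 0 0)
            (aemeasurable_det fun _ _ => hm _ _) hca (hlaw 0 0) hs indep_corner
      _ ≤ negMomentBound κ s * negMomentBound κ s ^ k := by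
          gcongr
          exact ih (hind.precomp succ_prod_injective) (fun _ _ => hm _ _) fun _ _ => hlaw _ _
      _ = negMomentBound κ s ^ (k + 1) := (pow_succ' _ _).symm

theorem ae_det_ne_zero {k : ℕ} {A : Ω → Matrix (Fin k) (Fin k) ℝ}
    (hind : iIndepFun (fun (p : Fin k × Fin k) ω => A ω p.1 p.2) μ)
    (hm : ∀ i j, AEMeasurable (fun ω => A ω i j) μ)
    (hlaw : ∀ i j, μ.map (fun ω => A ω i j) ≤ κ • volume) : ∀ᵐ ω ∂μ, (A ω).det ≠ 0 := by
  have moment_lt_top : ∫⁻ ω, ‖(A ω).det‖ₑ ^ (-(1 / 2) : ℝ) ∂μ < ∞ :=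
    (lintegral_enorm_det_rpow_neg_le hind hm hlaw (by norm_num)).trans_lt
      (ENNReal.pow_lt_top (negMomentBound_lt_top κ (by norm_num)))
  filter_upwards [ae_lt_top' ((aemeasurable_det hm).enorm.pow_const _) moment_lt_top.ne]
    with ω hω h0
  norm_num [h0] at hω

theorem integrable_abs_det_rpow_neg {k : ℕ} {A : Ω → Matrix (Fin k) (Fin k) ℝ}
    (hind : iIndepFun (fun (p : Fin k × Fin k) ω => A ω p.1 p.2) μ)
    (hm : ∀ i j, AEMeasurable (fun ω => A ω i j) μ)
    (hlaw : ∀ i j, μ.map (fun ω => A ω i j) ≤ κ • volume) (hs : 0 < s) (hs1 : s < 1) :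
    Integrable (fun ω => |(A ω).det| ^ (-s)) μ := by
  refine ⟨((aemeasurable_det hm).abs.pow_const _).aestronglyMeasurable, ?_⟩
  have enorm_rpow : ∀ᵐ ω ∂μ, ‖|(A ω).det| ^ (-s)‖ₑ = ‖(A ω).det‖ₑ ^ (-s) := by
    filter_upwards [ae_det_ne_zero hind hm hlaw] with ω hω
    exact enorm_abs_rpow hω _
  rw [HasFiniteIntegral, lintegral_congr_ae enorm_rpow]
  exact (lintegral_enorm_det_rpow_neg_le hind hm hlaw hs).trans_lt
    (ENNReal.pow_lt_top (negMomentBound_lt_top κ hs1))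

theorem abs_log_le_add_abs_rpow_neg {x t D : ℝ} (hD : D ≠ 0) (hDx : D ^ 2 ≤ x)
    (hxt : Real.log x ≤ t) (ht : 0 ≤ t) : |Real.log x| ≤ t + 4 * |D| ^ (-(1 / 2) : ℝ) := by
  have abs_pos : 0 < |D| := abs_pos.2 hD
  have rpow_pos := Real.rpow_pos_of_pos abs_pos (-(1 / 2) : ℝ)
  have log_sq_le : 2 * Real.log |D| ≤ Real.log x := by
    have := Real.log_le_log (by positivity) hDx
    rwa [← sq_abs, Real.log_pow, Nat.cast_ofNat] at this
  have log_rpow_le : -(1 / 2) * Real.log |D| ≤ |D| ^ (-(1 / 2) : ℝ) := by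
    rw [← Real.log_rpow abs_pos]
    exact Real.log_le_self rpow_pos.le
  rw [abs_le]
  constructor <;> linarith

theorem integrable_log_posEigenProd_mul_transpose {a b : ℕ} (hab : a ≤ b)
    {G : Ω → Matrix (Fin a) (Fin b) ℝ}
    (hind : iIndepFun (fun (p : Fin a × Fin b) ω => G ω p.1 p.2) μ)
    (hL2 : ∀ i j, MemLp (fun ω => G ω i j) 2 μ)
    (hlaw : ∀ i j, μ.map (fun ω => G ω i j) ≤ κ • volume) :
    Integrable (fun ω => Real.log (posEigenProd (G ω * (G ω)ᵀ))) μ := by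
  have hm (i j) : AEMeasurable (fun ω => G ω i j) μ := (hL2 i j).1.aemeasurable
  let D (ω : Ω) : ℝ := ((G ω).submatrix id (Fin.castLEEmb hab)).det
  have indep_minor := hind.precomp
    (Function.injective_id.prodMap (Fin.castLEEmb hab).injective)
  have minor_ne_zero : ∀ᵐ ω ∂μ, D ω ≠ 0 :=
    ae_det_ne_zero indep_minor (fun _ _ => hm _ _) fun _ _ => hlaw _ _
  have integrable_minor : Integrable (fun ω => |D ω| ^ (-(1 / 2) : ℝ)) μ :=
    integrable_abs_det_rpow_neg indep_minor (fun _ _ => hm _ _) (fun _ _ => hlaw _ _)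
      (by norm_num) (by norm_num)
  have integrable_trace : Integrable (fun ω => (G ω * (G ω)ᵀ).trace) μ := by
    simp only [Matrix.trace, Matrix.diag_apply, Matrix.mul_apply, Matrix.transpose_apply]
    exact integrable_finsetSum _ fun i _ => integrable_finsetSum _ fun j _ =>
      (hL2 i j).integrable_mul (hL2 i j)
  have aemeasurable_log : AEMeasurable (fun ω => Real.log (G ω * (G ω)ᵀ).det) μ := by
    refine Real.measurable_log.comp_aemeasurable (aemeasurable_det fun i j => ?_)
    simp only [Matrix.mul_apply, Matrix.transpose_apply]
    exact Finset.aemeasurable_fun_sum _ fun k _ => (hm i k).mul (hm j k)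
  have det_pos : ∀ᵐ ω ∂μ, 0 < (G ω * (G ω)ᵀ).det := by
    filter_upwards [minor_ne_zero] with ω hω
    exact (sq_pos_of_ne_zero hω).trans_le (sq_det_submatrix_le_det_mul_transpose _ _)
  have integrable_log_det : Integrable (fun ω => Real.log (G ω * (G ω)ᵀ).det) μ := by
    refine (integrable_trace.add (integrable_minor.const_mul 4)).mono'
      aemeasurable_log.aestronglyMeasurable ?_
    filter_upwards [minor_ne_zero, det_pos] with ω hω hpos
    exact abs_log_le_add_abs_rpow_neg hω (sq_det_submatrix_le_det_mul_transpose _ _)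
      (log_det_le_trace (posDef_mul_transpose hpos.ne')) (posSemidef_mul_transpose _).trace_nonneg
  refine integrable_log_det.congr ?_
  filter_upwards [det_pos] with ω hpos
  rw [posEigenProd_of_posDef (posDef_mul_transpose hpos.ne')]

end NegativeMoments

/-! ### Gram-Schmidt on the rows of a random matrix -/

section RandomGramSchmidt

theorem sq_mul_gramSchmidtRows_transpose_apply_self {ι n : Type*} [LinearOrder ι] [Finite ι]
    [LocallyFiniteOrderBot ι] [Fintype n] {M : Matrix ι n ℝ} (hM : LinearIndependent ℝ M.row)
    (i : ι) : (M * (gramSchmidtRows M)ᵀ) i i ^ 2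
      = ∑ a, M i a ^ 2 - ∑ j ∈ Finset.Iio i, (M * (gramSchmidtRows M)ᵀ) i j ^ 2 := by
  have := Fintype.ofFinite ι
  set K := M * (gramSchmidtRows M)ᵀ
  have gram_eq : K * Kᵀ = M * Mᵀ := by
    rw [Matrix.transpose_mul, Matrix.transpose_transpose, ← Matrix.mul_assoc,
      mul_gramSchmidtRows_transpose_mul hM]
  have sum_sq_row : ∑ j, K i j ^ 2 = ∑ a, M i a ^ 2 := by
    simpa only [Matrix.mul_apply, Matrix.transpose_apply, ← sq]
      using congrFun (congrFun gram_eq i) i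
  have K_lower : K.IsLowerTriangular := isLowerTriangular_mul_gramSchmidtRows_transpose M
  have sum_sq_Iic : ∑ j ∈ Finset.Iic i, K i j ^ 2 = ∑ j, K i j ^ 2 :=
    Finset.sum_subset (Finset.subset_univ _) fun j _ hj => by
      have hij : i < j := not_le.1 fun hji => hj (Finset.mem_Iic.2 hji)
      rw [K_lower hij, sq, mul_zero]
  rw [← sum_sq_row, ← sum_sq_Iic, ← Finset.Iio_insert, Finset.sum_insert (by simp),
    add_sub_cancel_right]

variable {Ω : Type*} [MeasurableSpace Ω] {μ : Measure Ω} {ι m n : Type*}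

theorem integral_sq_dotProduct_of_indepFun [Fintype n] [DecidableEq n] {w u : Ω → n → ℝ}
    (hw : ∀ a, MemLp (fun ω => w ω a) 2 μ) (hu : ∀ a, MemLp (fun ω => u ω a) 2 μ)
    (hww : ∀ a b, ∫ ω, w ω a * w ω b ∂μ = (1 : Matrix n n ℝ) a b) (hind : IndepFun w u μ) :
    ∫ ω, (w ω ⬝ᵥ u ω) ^ 2 ∂μ = ∫ ω, u ω ⬝ᵥ u ω ∂μ := by
  have integrable_ww (a b) : Integrable (fun ω => w ω a * w ω b) μ := (hw a).integrable_mul (hw b)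
  have integrable_uu (a b) : Integrable (fun ω => u ω a * u ω b) μ := (hu a).integrable_mul (hu b)
  have indep_products (a b) :
      IndepFun (fun ω => w ω a * w ω b) (fun ω => u ω a * u ω b) μ :=
    hind.comp (φ := fun x : n → ℝ => x a * x b) (ψ := fun y : n → ℝ => y a * y b)
      (by fun_prop) (by fun_prop)
  have integrable_term (a b) : Integrable (fun ω => w ω a * w ω b * (u ω a * u ω b)) μ :=
    (indep_products a b).integrable_mul (integrable_ww a b) (integrable_uu a b)
  calc ∫ ω, (w ω ⬝ᵥ u ω) ^ 2 ∂μ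
      = ∫ ω, ∑ a, ∑ b, w ω a * w ω b * (u ω a * u ω b) ∂μ := by
        simp only [dotProduct, sq, Finset.sum_mul_sum, mul_mul_mul_comm]
    _ = ∑ a, ∑ b, (1 : Matrix n n ℝ) a b * ∫ ω, u ω a * u ω b ∂μ := by
        rw [integral_finsetSum _ fun a _ => integrable_finsetSum _ fun b _ => integrable_term a b]
        refine Finset.sum_congr rfl fun a _ => ?_
        rw [integral_finsetSum _ fun b _ => integrable_term a b]
        refine Finset.sum_congr rfl fun b _ => ?_
        rw [(indep_products a b).integral_fun_mul_eq_mul_integral (integrable_ww a b).1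
          (integrable_uu a b).1, hww]
    _ = ∫ ω, u ω ⬝ᵥ u ω ∂μ := by
        simp only [Matrix.one_apply, ite_mul, one_mul, zero_mul, Finset.sum_ite_eq,
          Finset.mem_univ, if_true, dotProduct]
        rw [integral_finsetSum _ fun a _ => integrable_uu a a]

/-- The entries of the random matrix `G` are independent, centered and of variance one: the part of
the standard Gaussian law that determines the expected column norms of the LQ factor. -/
structure IsWhiteMatrix (μ : Measure Ω) (G : Ω → Matrix m n ℝ) : Prop where
  indep : iIndepFun (fun (p : m × n) ω => G ω p.1 p.2) μ
  memLp : ∀ k a, MemLp (fun ω => G ω k a) 2 μ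
  integral_eq_zero : ∀ k a, ∫ ω, G ω k a ∂μ = 0
  integral_sq : ∀ k a, ∫ ω, G ω k a ^ 2 ∂μ = 1

theorem IsWhiteMatrix.integral_mul_row [DecidableEq n] {G : Ω → Matrix m n ℝ}
    (hG : IsWhiteMatrix μ G) (k : m) (a b : n) :
    ∫ ω, G ω k a * G ω k b ∂μ = (1 : Matrix n n ℝ) a b := by
  rcases eq_or_ne a b with rfl | hab
  · simpa only [Matrix.one_apply_eq, sq] using hG.integral_sq k a
  · have indep_entries := hG.indep.indepFun (show (k, a) ≠ (k, b) by simpa using hab)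
    rw [indep_entries.integral_fun_mul_eq_mul_integral (hG.memLp k a).1 (hG.memLp k b).1,
      hG.integral_eq_zero, zero_mul, Matrix.one_apply_ne hab]

variable [Fintype n] [LinearOrder ι] [LocallyFiniteOrderBot ι]

theorem aemeasurable_gramSchmidtRows [Finite ι] {M : Ω → Matrix ι n ℝ}
    (hm : ∀ j a, AEMeasurable (fun ω => M ω j a) μ) (i : ι) :
    AEMeasurable (fun ω => gramSchmidtRows (M ω) i) μ :=
  (measurable_gramSchmidtRows i).comp_aemeasurable (f := fun ω j a => M ω j a) <|
    aemeasurable_pi_lambda _ fun j => aemeasurable_pi_lambda _ fun a => hm j a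

theorem memLp_gramSchmidtRows [IsFiniteMeasure μ] [Finite ι] {M : Ω → Matrix ι n ℝ}
    (hm : ∀ j a, AEMeasurable (fun ω => M ω j a) μ) (i : ι) (a : n) :
    MemLp (fun ω => gramSchmidtRows (M ω) i a) 2 μ := by
  have aemeasurable_entry : AEMeasurable (fun ω => gramSchmidtRows (M ω) i a) μ :=
    (measurable_pi_apply a).comp_aemeasurable (aemeasurable_gramSchmidtRows hm i)
  refine .of_bound aemeasurable_entry.aestronglyMeasurable 1 (.of_forall fun ω => ?_)
  rw [Real.norm_eq_abs, ← sq_le_one_iff_abs_le_one, sq]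
  exact (Finset.single_le_sum (f := fun b => gramSchmidtRows (M ω) i b * gramSchmidtRows (M ω) i b)
    (fun b _ => mul_self_nonneg _) (Finset.mem_univ a)).trans
    (dotProduct_gramSchmidtRows_self_le_one _ i)

theorem indepFun_row_gramSchmidtRows [Finite m] [WellFoundedLT ι] {G : Ω → Matrix m n ℝ}
    (hind : iIndepFun (fun (p : m × n) ω => G ω p.1 p.2) μ)
    (hm : ∀ k a, AEMeasurable (fun ω => G ω k a) μ) {f : ι → m} {k : m} {i : ι}
    (hk : ∀ j ≤ i, f j ≠ k) :
    IndepFun (G · k) (fun ω => gramSchmidtRows ((G ω).submatrix f id) i) μ := by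
  classical
  have := Fintype.ofFinite m
  let S : Finset (m × n) := {p | p.1 = k}
  let T : Finset (m × n) := {p | p.1 ≠ k}
  have mem_S (a : n) : (k, a) ∈ S := by simp [S]
  have disjoint_S_T : Disjoint S T := Finset.disjoint_filter_filter_not _ _ _
  let restore (y : T → ℝ) (j : ι) (a : n) : ℝ :=
    if h : (f j, a) ∈ T then y ⟨(f j, a), h⟩ else 0
  have measurable_restore : Measurable restore :=
    measurable_pi_lambda _ fun j => measurable_pi_lambda _ fun a => by
      by_cases h : (f j, a) ∈ T <;> simp only [restore, h, dite_true, dite_false] <;> fun_prop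
  have gramSchmidtRows_restore (ω : Ω) :
      gramSchmidtRows (.of (restore fun p => G ω p.1.1 p.1.2)) i
        = gramSchmidtRows ((G ω).submatrix f id) i := by
    refine gramSchmidtRows_congr i fun j hj => funext fun a => ?_
    have mem_T : (f j, a) ∈ T := by simpa [T] using hk j hj
    simp only [Matrix.of_apply, restore, mem_T, dite_true, Matrix.submatrix_apply, id]
  have indep_blocks := hind.indepFun_finset₀ S T disjoint_S_T fun p => hm p.1 p.2
  have := indep_blocks.comp (φ := fun (x : S → ℝ) a => x ⟨(k, a), mem_S a⟩)
    (by fun_prop) ((measurable_gramSchmidtRows i).comp measurable_restore)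
  simpa only [Function.comp_def, gramSchmidtRows_restore] using this

variable [IsProbabilityMeasure μ] {G : Ω → Matrix m n ℝ} (hG : IsWhiteMatrix μ G)

include hG

theorem integrable_sq_mul_gramSchmidtRows [Finite ι] (f : ι → m) (k : m) (i : ι) :
    Integrable (fun ω => (G ω * (gramSchmidtRows ((G ω).submatrix f id))ᵀ) k i ^ 2) μ := by
  have hm (k a) : AEMeasurable (fun ω => G ω k a) μ := (hG.memLp k a).1.aemeasurable
  have integrable_sq_row : Integrable (fun ω => ∑ a, G ω k a ^ 2) μ :=
    integrable_finsetSum _ fun a _ => (hG.memLp k a).integrable_sq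
  have aemeasurable_entry : AEMeasurable
      (fun ω => (G ω * (gramSchmidtRows ((G ω).submatrix f id))ᵀ) k i) μ :=
    Finset.aemeasurable_fun_sum _ fun a _ => (hm k a).mul
      (memLp_gramSchmidtRows (fun j b => hm (f j) b) i a).1.aemeasurable
  refine integrable_sq_row.mono' (aemeasurable_entry.pow_const 2).aestronglyMeasurable
    (.of_forall fun ω => ?_)
  rw [Real.norm_of_nonneg (sq_nonneg _), Matrix.mul_apply]
  refine (Finset.sum_mul_sq_le_sq_mul_sq _ _ _).trans
    (mul_le_of_le_one_right (Finset.sum_nonneg fun a _ => sq_nonneg _) ?_)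
  simpa only [dotProduct, ← sq, Matrix.transpose_apply] using
    dotProduct_gramSchmidtRows_self_le_one ((G ω).submatrix f id) i

variable {f : ι ↪ m}
  (hli : ∀ᵐ ω ∂μ, LinearIndependent ℝ ((G ω).submatrix f id).row)

include hli

theorem integral_sq_mul_gramSchmidtRows_of_forall_ne [Finite m] [Finite ι] {k : m} {i : ι}
    (hk : ∀ j ≤ i, f j ≠ k) :
    ∫ ω, (G ω * (gramSchmidtRows ((G ω).submatrix f id))ᵀ) k i ^ 2 ∂μ = 1 := by
  classical
  have hm (k a) : AEMeasurable (fun ω => G ω k a) μ := (hG.memLp k a).1.aemeasurable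
  have norm_sq_eq_one : (fun ω => gramSchmidtRows ((G ω).submatrix f id) i ⬝ᵥ
      gramSchmidtRows ((G ω).submatrix f id) i) =ᵐ[μ] fun _ => 1 := by
    filter_upwards [hli] with ω hω
    exact (congrFun (congrFun (gramSchmidtRows_mul_transpose hω) i) i).trans
      (Matrix.one_apply_eq i)
  calc ∫ ω, (G ω * (gramSchmidtRows ((G ω).submatrix f id))ᵀ) k i ^ 2 ∂μ
      = ∫ ω, gramSchmidtRows ((G ω).submatrix f id) i ⬝ᵥ
          gramSchmidtRows ((G ω).submatrix f id) i ∂μ :=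
        integral_sq_dotProduct_of_indepFun (hG.memLp k)
          (memLp_gramSchmidtRows (fun j b => hm (f j) b) i) (hG.integral_mul_row k)
          (indepFun_row_gramSchmidtRows hG.indep hm hk)
    _ = 1 := by rw [integral_congr_ae norm_sq_eq_one, integral_const, probReal_univ, one_smul]

theorem integral_sq_mul_gramSchmidtRows_self [Finite m] [Finite ι] (i : ι) :
    ∫ ω, (G ω * (gramSchmidtRows ((G ω).submatrix f id))ᵀ) (f i) i ^ 2 ∂μ
      = Fintype.card n - (Finset.Iio i).card := by
  have row_identity : (fun ω => (G ω * (gramSchmidtRows ((G ω).submatrix f id))ᵀ) (f i) i ^ 2)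
      =ᵐ[μ] fun ω => ∑ a, G ω (f i) a ^ 2 - ∑ j ∈ Finset.Iio i,
        (G ω * (gramSchmidtRows ((G ω).submatrix f id))ᵀ) (f i) j ^ 2 := by
    filter_upwards [hli] with ω hω
    exact sq_mul_gramSchmidtRows_transpose_apply_self hω i
  have integrable_row (a) : Integrable (fun ω => G ω (f i) a ^ 2) μ :=
    (hG.memLp (f i) a).integrable_sq
  have integrable_prev (j) := integrable_sq_mul_gramSchmidtRows hG f (f i) j
  have integral_prev : ∀ j ∈ Finset.Iio i,
      ∫ ω, (G ω * (gramSchmidtRows ((G ω).submatrix f id))ᵀ) (f i) j ^ 2 ∂μ = 1 := fun j hj =>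
    integral_sq_mul_gramSchmidtRows_of_forall_ne hG hli fun l hl =>
      f.injective.ne (hl.trans_lt (Finset.mem_Iio.1 hj)).ne
  rw [integral_congr_ae row_identity,
    integral_sub (integrable_finsetSum _ fun a _ => integrable_row a)
      (integrable_finsetSum _ fun j _ => integrable_prev j),
    integral_finsetSum _ fun a _ => integrable_row a,
    integral_finsetSum _ fun j _ => integrable_prev j, Finset.sum_congr rfl integral_prev]
  simp only [hG.integral_sq, Finset.sum_const, Finset.card_univ, nsmul_eq_mul, mul_one]

theorem integral_sum_sq_mul_gramSchmidtRows [Fintype m] [Finite ι] (i : ι) :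
    ∫ ω, ∑ k, (G ω * (gramSchmidtRows ((G ω).submatrix f id))ᵀ) k i ^ 2 ∂μ
      = Fintype.card n + Fintype.card m - 2 * (Finset.Iio i).card - 1 := by
  classical
  let E (k : m) := ∫ ω, (G ω * (gramSchmidtRows ((G ω).submatrix f id))ᵀ) k i ^ 2 ∂μ
  let I : Finset m := (Finset.Iic i).map f
  have card_I : I.card = (Finset.Iio i).card + 1 := by
    rw [Finset.card_map, ← Finset.Iio_insert, Finset.card_insert_of_notMem (by simp)]
  have sum_I : ∑ k ∈ I, E k = Fintype.card n - (Finset.Iio i).card := by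
    have above_diag : ∀ j ∈ Finset.Iio i, E (f j) = 0 := fun j hj => by
      have entry_eq_zero (ω) :
          (G ω * (gramSchmidtRows ((G ω).submatrix f id))ᵀ) (f j) i = 0 :=
        isLowerTriangular_mul_gramSchmidtRows_transpose ((G ω).submatrix f id)
          (OrderDual.toDual_lt_toDual.2 (Finset.mem_Iio.1 hj))
      simp only [E, entry_eq_zero, sq, mul_zero, integral_zero]
    rw [Finset.sum_map, ← Finset.Iio_insert, Finset.sum_insert (by simp),
      Finset.sum_eq_zero above_diag, add_zero]
    exact integral_sq_mul_gramSchmidtRows_self hG hli i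
  have sum_compl : ∑ k ∈ Iᶜ, E k = Fintype.card m - ((Finset.Iio i).card + 1) := by
    have outside : ∀ k ∈ Iᶜ, E k = 1 := fun k hk =>
      integral_sq_mul_gramSchmidtRows_of_forall_ne hG hli fun j hj hjk =>
        Finset.mem_compl.1 hk (Finset.mem_map.2 ⟨j, Finset.mem_Iic.2 hj, hjk⟩)
    rw [Finset.sum_congr rfl outside, Finset.sum_const, nsmul_one, Finset.card_compl,
      Nat.cast_sub (Finset.card_le_univ I), card_I, Nat.cast_add_one]
  rw [integral_finsetSum _ fun k _ => integrable_sq_mul_gramSchmidtRows hG f k i,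
    ← Finset.sum_add_sum_compl I, sum_I, sum_compl]
  ring

end RandomGramSchmidt

section Gaussian

theorem gaussianReal_zero_one_le_volume : gaussianReal 0 1 ≤ volume := by
  have density_le_one (x : ℝ) : gaussianPDF 0 1 x ≤ 1 := by
    have one_le_sqrt : 1 ≤ √(2 * Real.pi * (1 : NNReal)) := by
      rw [Real.one_le_sqrt, NNReal.coe_one]
      linarith [Real.pi_gt_three]
    refine ENNReal.ofReal_le_one.2 (mul_le_one₀ (inv_le_one_of_one_le₀ one_le_sqrt)
      (Real.exp_pos _).le (Real.exp_le_one_iff.2 ?_))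
    exact div_nonpos_of_nonpos_of_nonneg (neg_nonpos.2 (sq_nonneg _)) (by positivity)
  rw [gaussianReal_of_var_ne_zero _ one_ne_zero]
  exact (withDensity_mono (.of_forall density_le_one)).trans withDensity_one.le

variable {Ω : Type*} [MeasurableSpace Ω] {μ : Measure Ω}

theorem iIndepFun_uncurry_of_aemeasurable [IsProbabilityMeasure μ] {ι κ E : Type*} [Finite κ]
    [MeasurableSpace E] {X : ι → κ → Ω → E} (hm : ∀ i j, AEMeasurable (X i j) μ)
    (hrows : iIndepFun (fun i ω j => X i j ω) μ) (hrow : ∀ i, iIndepFun (X i) μ) :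
    iIndepFun (fun p : ι × κ => X p.1 p.2) μ := by
  have ae_eq_mk (i) : ∀ᵐ ω ∂μ, (fun j => X i j ω) = fun j => (hm i j).mk _ ω := by
    filter_upwards [ae_all_iff.2 fun j => (hm i j).ae_eq_mk] with ω hω
    exact funext hω
  exact (iIndepFun_uncurry' (fun i j => (hm i j).measurable_mk) (hrows.congr ae_eq_mk)
    fun i => (hrow i).congr fun j => (hm i j).ae_eq_mk).congr fun p => (hm p.1 p.2).ae_eq_mk.symm

theorem hasLaw_ofLp_of_stdGaussian {ι : Type*} [Fintype ι] {Y : Ω → EuclideanSpace ℝ ι}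
    (hY : HasLaw Y (stdGaussian (EuclideanSpace ℝ ι)) μ) :
    HasLaw (fun ω => (Y ω).ofLp) (.pi fun _ => gaussianReal 0 1) μ := by
  refine HasLaw.fun_comp (Y := WithLp.ofLp) ⟨by fun_prop, ?_⟩ hY
  rw [← map_pi_eq_stdGaussian, Measure.map_map (by fun_prop) (by fun_prop)]
  exact Measure.map_id

namespace IsStdGaussianMatrix

variable {r n : ℕ} {Z : Ω → Matrix (Fin r) (Fin n) ℝ} (hZ : IsStdGaussianMatrix μ Z)

include hZ

theorem hasLaw_apply (k : Fin r) (a : Fin n) :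
    HasLaw (fun ω => Z ω k a) (gaussianReal 0 1) μ :=
  (measurePreserving_eval (fun _ : Fin r => gaussianReal 0 1) k).fun_comp_hasLaw
    (hasLaw_ofLp_of_stdGaussian (hZ.law_col a))

theorem map_apply_le_volume (k : Fin r) (a : Fin n) :
    μ.map (fun ω => Z ω k a) ≤ (1 : NNReal) • volume := by
  rw [(hZ.hasLaw_apply k a).map_eq, one_smul]
  exact gaussianReal_zero_one_le_volume

theorem memLp_apply (k : Fin r) (a : Fin n) : MemLp (fun ω => Z ω k a) 2 μ := by
  have memLp_id : MemLp id 2 (μ.map fun ω => Z ω k a) :=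
    (hZ.hasLaw_apply k a).map_eq ▸ memLp_id_gaussianReal 2
  exact memLp_id.comp_of_map (hZ.hasLaw_apply k a).aemeasurable

theorem orthogonal_mul {O : Matrix (Fin r) (Fin r) ℝ} (hO : O * Oᵀ = 1) :
    IsStdGaussianMatrix μ fun ω => O * Z ω := by
  let u : unitary (EuclideanSpace ℝ (Fin r) →L[ℝ] EuclideanSpace ℝ (Fin r)) :=
    ⟨toEuclideanCLM (𝕜 := ℝ) O,
      Unitary.map_mem toEuclideanCLM (Unitary.mem_iff.2 ⟨mul_eq_one_comm.1 hO, hO⟩)⟩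
  let e := Unitary.linearIsometryEquiv u
  have col_eq (a : Fin n) : (fun ω => WithLp.toLp 2 fun k => (O * Z ω) k a)
      = fun ω => e (WithLp.toLp 2 fun k => Z ω k a) := rfl
  have hasLaw_e : HasLaw e (stdGaussian (EuclideanSpace ℝ (Fin r)))
      (stdGaussian (EuclideanSpace ℝ (Fin r))) :=
    ⟨e.continuous.measurable.aemeasurable, stdGaussian_map e⟩
  refine ⟨fun a => ?_, ?_⟩
  · rw [col_eq]
    exact hasLaw_e.fun_comp (hZ.law_col a)
  · rw [funext col_eq]
    exact hZ.indep_col.comp (fun _ => e) fun _ => e.continuous.measurable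

variable [IsProbabilityMeasure μ]

theorem iIndepFun_apply : iIndepFun (fun (p : Fin r × Fin n) ω => Z ω p.1 p.2) μ := by
  have indep_cols : iIndepFun (fun (a : Fin n) ω (k : Fin r) => Z ω k a) μ :=
    hZ.indep_col.comp (fun _ => WithLp.ofLp) fun _ => by fun_prop
  have indep_in_col (a : Fin n) : iIndepFun (fun k ω => Z ω k a) μ :=
    (iIndepFun_iff_hasLaw_pi_pi fun k => hZ.hasLaw_apply k a).2
      (hasLaw_ofLp_of_stdGaussian (hZ.law_col a))
  exact (iIndepFun_uncurry_of_aemeasurable (fun a k => (hZ.hasLaw_apply k a).aemeasurable)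
    indep_cols indep_in_col).precomp Prod.swap_injective

theorem isWhiteMatrix : IsWhiteMatrix μ Z where
  indep := hZ.iIndepFun_apply
  memLp := hZ.memLp_apply
  integral_eq_zero k a := by rw [(hZ.hasLaw_apply k a).integral_eq, integral_id_gaussianReal]
  integral_sq k a := by
    have law := hZ.hasLaw_apply k a
    rw [← variance_of_integral_eq_zero law.aemeasurable
      (by rw [law.integral_eq, integral_id_gaussianReal]), law.variance_eq,
      variance_id_gaussianReal, NNReal.coe_one]

theorem ae_linearIndependent_submatrix {q : ℕ} (f : Fin q ↪ Fin r) (hq : q ≤ n) :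
    ∀ᵐ ω ∂μ, LinearIndependent ℝ ((Z ω).submatrix f id).row := by
  have indep_minor := hZ.iIndepFun_apply.precomp
    (f.injective.prodMap (Fin.castLEEmb hq).injective)
  filter_upwards [ae_det_ne_zero (A := fun ω => (Z ω).submatrix f (Fin.castLEEmb hq)) indep_minor
    (fun _ _ => (hZ.hasLaw_apply _ _).aemeasurable) fun _ _ => hZ.map_apply_le_volume _ _]
    with ω hω
  exact linearIndependent_row_of_det_submatrix_ne_zero (e := Fin.castLEEmb hq) hω

theorem integrable_log_posEigenProd :
    Integrable (fun ω => Real.log (posEigenProd (Z ω * (Z ω)ᵀ))) μ := by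
  rcases le_total r n with h | h
  · exact integrable_log_posEigenProd_mul_transpose h hZ.iIndepFun_apply hZ.memLp_apply
      hZ.map_apply_le_volume
  · simp only [posEigenProd_mul_comm (Z _)]
    exact integrable_log_posEigenProd_mul_transpose (G := fun ω => (Z ω)ᵀ) h
      (hZ.iIndepFun_apply.precomp Prod.swap_injective) (fun _ _ => hZ.memLp_apply _ _)
      fun _ _ => hZ.map_apply_le_volume _ _

end IsStdGaussianMatrix

end Gaussian

/-! ### Risks of the estimators -/

section Risk

theorem neg_log_lt_div_sub_log_sub_one {c d : ℝ} (hc : 0 < c) (hd : 0 < d) (h : d ≠ c) :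
    -Real.log c < d / c - Real.log d - 1 := by
  have log_lt := Real.log_lt_sub_one_of_pos (div_pos hd hc) (div_ne_one_of_ne h)
  rw [Real.log_div hd.ne' hc.ne'] at log_lt
  linarith

theorem sum_sub_log_sub_one_lt_of_ne {ι : Type*} [Fintype ι] {c d : ι → ℝ} (hc : ∀ i, 0 < c i)
    (hd : ∀ i, 0 < d i) (h : d ≠ c) :
    ∑ i, -Real.log (c i) < ∑ i, (d i / c i - Real.log (d i) - 1) := by
  have le (i : ι) : -Real.log (c i) ≤ d i / c i - Real.log (d i) - 1 := by
    rcases eq_or_ne (d i) (c i) with h | h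
    · rw [h, div_self (hc i).ne']
      linarith
    · exact (neg_log_lt_div_sub_log_sub_one (hc i) (hd i) h).le
  obtain ⟨i, hi⟩ := Function.ne_iff.1 h
  exact Finset.sum_lt_sum (fun i _ => le i)
    ⟨i, Finset.mem_univ i, neg_log_lt_div_sub_log_sub_one (hc i) (hd i) hi⟩

theorem inv_dJS (n r : ℕ) (i : Fin (min n r)) :
    (dJS n r i)⁻¹ = (n : ℝ) + (r : ℝ) - 2 * ((i : ℝ) + 1) + 1 := by
  rw [dJS, one_div, inv_inv]

theorem dJS_pos (n r : ℕ) (i : Fin (min n r)) : 0 < dJS n r i := by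
  have lt_n : (i : ℝ) + 1 ≤ n := by exact_mod_cast (lt_min_iff.1 i.2).1
  have lt_r : (i : ℝ) + 1 ≤ r := by exact_mod_cast (lt_min_iff.1 i.2).2
  exact one_div_pos.2 (by linarith)

theorem dJS_injective (n r : ℕ) : Function.Injective (dJS n r) := by
  intro i j hij
  have h := congrArg Inv.inv hij
  rw [inv_dJS, inv_dJS] at h
  exact Fin.ext (by exact_mod_cast (by linarith : (i : ℝ) = j))

theorem sum_inv_dJS (n r : ℕ) :
    ∑ i, (dJS n r i)⁻¹ = ((min n r : ℕ) : ℝ) * (max n r : ℕ) := by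
  have sum_eq (x : ℝ) (q : ℕ) : ∑ i : Fin q, (x - 2 * ((i : ℝ) + 1) + 1) = q * (x - q) := by
    induction q with
    | zero => simp
    | succ q ih =>
      rw [Fin.sum_univ_castSucc]
      simp only [Fin.val_castSucc, Fin.val_last, ih]
      push_cast
      ring
  have min_add_max : ((min n r : ℕ) : ℝ) + (max n r : ℕ) = n + r := by
    exact_mod_cast min_add_max n r
  simp only [inv_dJS, sum_eq, ← min_add_max, add_sub_cancel_left]

theorem sum_sq_orthogonal_mul {m n : Type*} [Fintype m] [DecidableEq m] {O : Matrix m m ℝ}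
    (hO : O * Oᵀ = 1) (A : Matrix m n ℝ) (i : n) :
    ∑ k, (O * A) k i ^ 2 = ∑ k, A k i ^ 2 := by
  have sum_sq (M : Matrix m n ℝ) : ∑ k, M k i ^ 2 = (Mᵀ * M) i i := by
    simp only [mul_apply, transpose_apply, ← sq]
  rw [sum_sq, sum_sq, transpose_mul, Matrix.mul_assoc, ← Matrix.mul_assoc Oᵀ,
    mul_eq_one_comm.1 hO, Matrix.one_mul]

variable {Ω : Type*} [MeasurableSpace Ω] {μ : Measure Ω} [IsProbabilityMeasure μ] {p n r : ℕ}
  {Z : Ω → Matrix (Fin r) (Fin n) ℝ} {ρ : Fin (min n r) ↪ Fin p} {B : Matrix (Fin p) (Fin r) ℝ}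
  (hZ : IsStdGaussianMatrix μ Z) (hB : B ∈ paramSpace ρ)

include hZ hB

theorem exists_ae_isLQ_integral_sum_sq_mul :
    ∃ V : Ω → Matrix (Fin n) (Fin (min n r)) ℝ,
      (∀ᵐ ω ∂μ, ∃ T, IsLQ ρ (B * Z ω) T (V ω)) ∧
      ∀ i, Integrable (fun ω => ∑ k, (Z ω * V ω) k i ^ 2) μ ∧
        ∫ ω, ∑ k, (Z ω * V ω) k i ^ 2 ∂μ = (dJS n r i)⁻¹ := by
  let f : Fin (min n r) ↪ Fin r := Fin.castLEEmb (min_le_right n r)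
  have hf : Function.Surjective f ∨ min n r = n := by
    rcases le_total n r with h | h
    · exact .inr (min_eq_left h)
    · exact .inl ((Function.Injective.bijective_of_nat_card_le f.injective
        (by simp [min_eq_right h])).surjective)
  have hli : LinearIndependent ℝ (B.submatrix ρ id).row := by
    rw [linearIndependent_iff_card_eq_finrank_span, Fintype.card_fin, Set.finrank,
      ← rank_eq_finrank_span_row, hB.2]
  obtain ⟨L, O, hL, hO, hLO⟩ := exists_isPosLower_mul_orthogonal hli f
  have hOZ := hZ.orthogonal_mul hO
  have hOZ_li := hOZ.ae_linearIndependent_submatrix f (min_le_left n r)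
  refine ⟨fun ω => (gramSchmidtRows ((O * Z ω).submatrix f id))ᵀ, ?_, fun i => ?_⟩
  · filter_upwards [hOZ_li] with ω hω
    exact ⟨_, isLQ_gramSchmidtRows hf hL hO hLO hω⟩
  · have sum_sq_eq (ω : Ω) (V : Matrix (Fin n) (Fin (min n r)) ℝ) :
        ∑ k, (Z ω * V) k i ^ 2 = ∑ k, (O * Z ω * V) k i ^ 2 := by
      rw [Matrix.mul_assoc, sum_sq_orthogonal_mul hO]
    simp only [sum_sq_eq]
    refine ⟨integrable_finsetSum _ fun k _ =>
      integrable_sq_mul_gramSchmidtRows hOZ.isWhiteMatrix f k i, ?_⟩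
    rw [integral_sum_sq_mul_gramSchmidtRows hOZ.isWhiteMatrix hOZ_li, inv_dJS, Fin.card_Iio,
      Fintype.card_fin, Fintype.card_fin]
    ring

theorem ae_existsUnique_isLQ :
    ∀ᵐ ω ∂μ, ∃! TV : Matrix (Fin p) (Fin (min n r)) ℝ × Matrix (Fin n) (Fin (min n r)) ℝ,
      IsLQ ρ (B * Z ω) TV.1 TV.2 := by
  obtain ⟨V, hV, -⟩ := exists_ae_isLQ_integral_sum_sq_mul hZ hB
  filter_upwards [hV] with ω ⟨T, hTV⟩
  refine ⟨(T, V ω), hTV, fun TV' h' => ?_⟩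
  obtain ⟨hT, hV⟩ := h'.unique hTV
  exact Prod.ext hT hV

theorem integrable_lossVar_deltaT_and_risk_deltaT {d : Fin (min n r) → ℝ} (hd : ∀ i, 0 < d i) :
    Integrable (lossVar Z (deltaT ρ d) B) μ ∧
      risk μ Z (deltaT ρ d) B = ∑ i, (d i / dJS n r i - Real.log (d i) - 1)
        - ∫ ω, Real.log (posEigenProd (Z ω * (Z ω)ᵀ)) ∂μ := by
  obtain ⟨V, hV, hZV⟩ := exists_ae_isLQ_integral_sum_sq_mul hZ hB
  let N (i : Fin (min n r)) (ω : Ω) : ℝ := ∑ k, (Z ω * V ω) k i ^ 2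
  have loss_eq : lossVar Z (deltaT ρ d) B =ᵐ[μ] fun ω =>
      ∑ i, (d i * N i ω - Real.log (d i) - 1) - Real.log (posEigenProd (Z ω * (Z ω)ᵀ)) := by
    filter_upwards [hV] with ω ⟨T, hTV⟩
    rw [lossVar, deltaT, hTV.lqT_eq, steinLoss_of_isLQ hB.1 hTV hd, Finset.sum_sub_distrib,
      Finset.sum_sub_distrib, Fin.sum_const, nsmul_one]
    ring
  have integrable_mul (i) : Integrable (fun ω => d i * N i ω) μ := (hZV i).1.const_mul _
  have integrable_sub_log (i) : Integrable (fun ω => d i * N i ω - Real.log (d i)) μ :=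
    (integrable_mul i).sub (integrable_const _)
  have integrable_term (i) : Integrable (fun ω => d i * N i ω - Real.log (d i) - 1) μ :=
    (integrable_sub_log i).sub (integrable_const _)
  have integrable_sum := integrable_finsetSum Finset.univ fun i _ => integrable_term i
  have integral_term (i) : ∫ ω, (d i * N i ω - Real.log (d i) - 1) ∂μ
      = d i / dJS n r i - Real.log (d i) - 1 := by
    rw [integral_sub (integrable_sub_log i) (integrable_const _),
      integral_sub (integrable_mul i) (integrable_const _), integral_const_mul, (hZV i).2,
      integral_const, integral_const, probReal_univ, one_smul, one_smul, div_eq_mul_inv]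
  refine ⟨(integrable_sum.sub hZ.integrable_log_posEigenProd).congr loss_eq.symm, ?_⟩
  rw [risk, integral_congr_ae loss_eq, integral_sub integrable_sum hZ.integrable_log_posEigenProd,
    integral_finsetSum _ fun i _ => integrable_term i,
    Finset.sum_congr rfl fun i _ => integral_term i]

theorem integrable_lossVar_deltaT {d : Fin (min n r) → ℝ} (hd : ∀ i, 0 < d i) :
    Integrable (lossVar Z (deltaT ρ d) B) μ :=
  (integrable_lossVar_deltaT_and_risk_deltaT hZ hB hd).1

theorem risk_deltaT {d : Fin (min n r) → ℝ} (hd : ∀ i, 0 < d i) :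
    risk μ Z (deltaT ρ d) B = ∑ i, (d i / dJS n r i - Real.log (d i) - 1)
      - ∫ ω, Real.log (posEigenProd (Z ω * (Z ω)ᵀ)) ∂μ :=
  (integrable_lossVar_deltaT_and_risk_deltaT hZ hB hd).2

theorem risk_deltaT_dJS :
    risk μ Z (deltaT ρ (dJS n r)) B = ∑ i, -Real.log (dJS n r i)
      - ∫ ω, Real.log (posEigenProd (Z ω * (Z ω)ᵀ)) ∂μ := by
  rw [risk_deltaT hZ hB (dJS_pos n r)]
  simp only [div_self (dJS_pos n r _).ne', sub_right_comm, sub_self, zero_sub]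

theorem risk_deltaT_dJS_lt {d : Fin (min n r) → ℝ} (hd : ∀ i, 0 < d i) (h : d ≠ dJS n r) :
    risk μ Z (deltaT ρ (dJS n r)) B < risk μ Z (deltaT ρ d) B := by
  rw [risk_deltaT_dJS hZ hB, risk_deltaT hZ hB hd]
  exact sub_lt_sub_right (sum_sub_log_sub_one_lt_of_ne (dJS_pos n r) hd h) _

theorem lossVar_deltaT_const_ae_eq (a : ℝ) :
    lossVar Z (deltaT ρ fun _ => a) B =ᵐ[μ] lossVar Z (deltaC a) B := by
  filter_upwards [ae_existsUnique_isLQ hZ hB] with ω ⟨⟨T, V⟩, hTV, _⟩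
  have mul_transpose : B * Z ω * (B * Z ω)ᵀ = T * Tᵀ := by
    rw [hTV.eq_mul, transpose_mul, transpose_transpose, Matrix.mul_assoc, ← Matrix.mul_assoc Vᵀ,
      hTV.orthonormal, Matrix.one_mul]
  rw [lossVar, lossVar, deltaT, deltaC, hTV.lqT_eq, mul_transpose, ← smul_one_eq_diagonal,
    Matrix.mul_smul, Matrix.mul_one, Matrix.smul_mul]

theorem integrable_lossVar_deltaC {a : ℝ} (ha : 0 < a) :
    Integrable (lossVar Z (deltaC a) B) μ :=
  (integrable_lossVar_deltaT hZ hB fun _ => ha).congr (lossVar_deltaT_const_ae_eq hZ hB a)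

theorem risk_deltaC_eq_risk_deltaT (a : ℝ) :
    risk μ Z (deltaC a) B = risk μ Z (deltaT ρ fun _ => a) B :=
  (integral_congr_ae (lossVar_deltaT_const_ae_eq hZ hB a)).symm

theorem risk_deltaC {a : ℝ} (ha : 0 < a) :
    risk μ Z (deltaC a) B = (min n r : ℕ) * (a * (max n r : ℕ) - Real.log a - 1)
      - ∫ ω, Real.log (posEigenProd (Z ω * (Z ω)ᵀ)) ∂μ := by
  simp only [risk_deltaC_eq_risk_deltaT hZ hB, risk_deltaT hZ hB fun _ => ha, div_eq_mul_inv,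
    Finset.sum_sub_distrib, ← Finset.mul_sum, sum_inv_dJS, Fin.sum_const, nsmul_eq_mul]
  ring

theorem risk_deltaBC_lt_risk_deltaC (hq : 0 < min n r) {a : ℝ} (ha : 0 < a)
    (h : a ≠ 1 / (max n r : ℕ)) : risk μ Z (deltaBC r) B < risk μ Z (deltaC a) B := by
  have hm := one_div_pos.2 (Nat.cast_pos (α := ℝ).2 (hq.trans_le min_le_max))
  have risk_deltaBC : risk μ Z (deltaBC r) B = _ := risk_deltaC hZ hB hm
  rw [risk_deltaBC, risk_deltaC hZ hB ha]
  refine sub_lt_sub_right (mul_lt_mul_of_pos_left ?_ (Nat.cast_pos.2 hq)) _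
  have log_lt := neg_log_lt_div_sub_log_sub_one hm ha h
  rw [div_div_eq_mul_div, div_one] at log_lt
  rw [one_div_mul_cancel (one_div_pos.1 hm).ne']
  linarith

theorem risk_deltaT_dJS_lt_risk_deltaBC (hq : 2 ≤ min n r) :
    risk μ Z (deltaT ρ (dJS n r)) B < risk μ Z (deltaBC r) B := by
  have hm : 0 < max n r := by omega
  refine (risk_deltaT_dJS_lt hZ hB (fun _ => one_div_pos.2 (Nat.cast_pos.2 hm))
    fun h => ?_).trans_eq (risk_deltaC_eq_risk_deltaT hZ hB _).symm
  have zero_eq_one : (⟨0, by omega⟩ : Fin (min n r)) = ⟨1, hq⟩ :=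
    dJS_injective n r (by rw [← h])
  exact zero_ne_one (congrArg Fin.val zero_eq_one)

theorem risk_deltaT_dJS_le_risk_deltaBC (hm : 0 < max n r) :
    risk μ Z (deltaT ρ (dJS n r)) B ≤ risk μ Z (deltaBC r) B := by
  refine le_of_le_of_eq ?_ (risk_deltaC_eq_risk_deltaT hZ hB _).symm
  rcases eq_or_ne (fun _ => 1 / ((max n r : ℕ) : ℝ)) (dJS n r) with h | h
  · rw [h]
  · exact (risk_deltaT_dJS_lt hZ hB (fun _ => one_div_pos.2 (Nat.cast_pos.2 hm)) h).le

end Risk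

end SingularWishart

theorem mainTheorem5 {Ω : Type*} [MeasurableSpace Ω] (μ : Measure Ω) [IsProbabilityMeasure μ]
    (p n r : ℕ) (hn : 0 < n) (hr : 0 < r)
    (Z : Ω → Matrix (Fin r) (Fin n) ℝ) (hZ : SingularWishart.IsStdGaussianMatrix μ Z)
    (ρ : Fin (min n r) ↪ Fin p)
    (B : Matrix (Fin p) (Fin r) ℝ) (hB : B ∈ SingularWishart.paramSpace ρ) :
    -- the decomposition exists and is unique with probability one
    (∀ᵐ ω ∂μ, ∃! TV : Matrix (Fin p) (Fin (min n r)) ℝ × Matrix (Fin n) (Fin (min n r)) ℝ,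
      SingularWishart.IsLQ ρ (B * Z ω) TV.1 TV.2) ∧
    -- all risks are finite
    (∀ d : Fin (min n r) → ℝ, (∀ i, 0 < d i) →
      Integrable (SingularWishart.lossVar Z (SingularWishart.deltaT ρ d) B) μ) ∧
    (∀ a : ℝ, 0 < a → Integrable (SingularWishart.lossVar Z (SingularWishart.deltaC a) B) μ) ∧
    Integrable (SingularWishart.lossVar Z (SingularWishart.deltaBC r) B) μ ∧
    -- the constants `dJS` are admissible, and they give the unique best estimator in the class
    (∀ i, 0 < SingularWishart.dJS n r i) ∧
    (∀ d : Fin (min n r) → ℝ, (∀ i, 0 < d i) → d ≠ SingularWishart.dJS n r →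
      SingularWishart.risk μ Z (SingularWishart.deltaT ρ (SingularWishart.dJS n r)) B
        < SingularWishart.risk μ Z (SingularWishart.deltaT ρ d) B) ∧
    -- its risk is a constant that does not depend on `B`
    Integrable (fun ω => Real.log (SingularWishart.posEigenProd (Z ω * (Z ω)ᵀ))) μ ∧
    SingularWishart.risk μ Z (SingularWishart.deltaT ρ (SingularWishart.dJS n r)) B
      = ∑ i : Fin (min n r), Real.log ((n : ℝ) + (r : ℝ) - 2 * ((i : ℝ) + 1) + 1)
        - ∫ ω, Real.log (SingularWishart.posEigenProd (Z ω * (Z ω)ᵀ)) ∂μ ∧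
    -- `S / max n r` is the unique best constant multiple of `S`
    (∀ a : ℝ, 0 < a → a ≠ 1 / ((max n r : ℕ) : ℝ) →
      SingularWishart.risk μ Z (SingularWishart.deltaBC r) B
        < SingularWishart.risk μ Z (SingularWishart.deltaC a) B) ∧
    -- the estimator with the constants `dJS` dominates the best constant multiple estimator
    SingularWishart.risk μ Z (SingularWishart.deltaT ρ (SingularWishart.dJS n r)) B
      ≤ SingularWishart.risk μ Z (SingularWishart.deltaBC r) B ∧
    (2 ≤ min n r →
      SingularWishart.risk μ Z (SingularWishart.deltaT ρ (SingularWishart.dJS n r)) B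
        < SingularWishart.risk μ Z (SingularWishart.deltaBC r) B) := by
  have hq : 0 < min n r := lt_min hn hr
  have hm : 0 < max n r := lt_max_of_lt_left hn
  refine ⟨SingularWishart.ae_existsUnique_isLQ hZ hB,
    fun d hd => SingularWishart.integrable_lossVar_deltaT hZ hB hd,
    fun a ha => SingularWishart.integrable_lossVar_deltaC hZ hB ha,
    SingularWishart.integrable_lossVar_deltaC hZ hB (one_div_pos.2 (Nat.cast_pos.2 hm)),
    SingularWishart.dJS_pos n r,
    fun d hd h => SingularWishart.risk_deltaT_dJS_lt hZ hB hd h,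
    hZ.integrable_log_posEigenProd, ?_,
    fun a ha h => SingularWishart.risk_deltaBC_lt_risk_deltaC hZ hB hq ha h,
    SingularWishart.risk_deltaT_dJS_le_risk_deltaBC hZ hB hm,
    SingularWishart.risk_deltaT_dJS_lt_risk_deltaBC hZ hB⟩
  simp only [SingularWishart.risk_deltaT_dJS hZ hB, ← Real.log_inv, SingularWishart.inv_dJS]
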